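/- Let $\mathfrak g$ be a complex semisimple Lie algebra with Cartan subalgebra $\mathfrak h$, simple roots $\alpha_i$ and simple coroots $\alpha_i^\vee$ ($i\in I$), and Chevalley generators $e_i,f_i$. Let $\mathrm{Indep}(I)$ be the collection of subsets $H\subset I$ that span no edge of the Dynkin diagram (including $\emptyset$). For $\mathcal H\subset\mathrm{Indep}(I)$, let $\mathcal H^{\min}$ be the set of its inclusion-minimal members, and let $\mathcal O^{\mathcal H}$ be the full subcategory of the BGG category $\mathcal O$ of objects on which $\mathbf f_H=\prod_{h\in H}f_h$ acts locally nilpotently for all $H\in\mathcal H$. For $\lambda\in\mathfrak h^*$ let $M(\lambda)$ be the Verma module, $L(\lambda)$ its simple quotient, $J_\lambda=\{i\in I:\langle\lambda,\alpha_i^\vee\rangle\in\mathbb Z_{\ge0}\}$, and $$\mathcal H'_\lambda=\{J_\lambda\cap H: H\in\mathcal H^{\min}\},\qquad \mathbb M(\lambda,\mathcal H)=\frac{M(\lambda)}{\sum_{H\in\mathcal H^{\min}}U\mathfrak g\Bigl(\prod_{h\in J_\lambda\cap H}f_h^{\langle\lambda,\alpha_h^\vee\rangle+1}\Bigr)M(\lambda)_\lambda}$$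 (an empty product is $1$). For a quotient $V$ of $M(\lambda)$ let $\mathcal H_V$ be the set of all $H\in\mathrm{Indep}(I)$ with $H\subset J_\lambda$ and $\prod_{h\in H}f_h^{\langle\lambda,\alpha_h^\vee\rangle+1}V_\lambda=0$. Fix a nonempty $\mathcal H\subset\mathrm{Indep}(I)$ and $\lambda\in\mathfrak h^*$. Then: 1. $L(\lambda)\in\mathcal O^{\mathcal H}$ if and only if $J_\lambda\cap H\ne\emptyset$ for all $H\in\mathcal H^{\min}$, if and only if $\mathbb M(\lambda,\mathcal H)\neq0$. 2. In this case $\mathbb M(\lambda,\mathcal H)=\mathbb M(\lambda,\mathcal H'_\lambda)$ (equality of quotients of $M(\lambda)$), and this module is the universal highest weight cover of $L(\lambda)$ in $\mathcal O^{\mathcal H}$: it is a quotient of $M(\lambda)$ lying in $\mathcal O^{\mathcal H}$, and it has a surjection $p$ onto $L(\lambda)$ such that for every quotient $V$ of $M(\lambda)$ lying in $\mathcal O^{\mathcal H}$ and every surjection $q:V\to L(\lambda)$ there is a unique homomorphism $g:\mathbb M(\lambda,\mathcal H)\to V$ with $q\circ g=p$, and this $g$ is surjective. 3. Suppose $L(\lambda)\in\mathcal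 O^{\mathcal H}$. A quotient $V$ of $M(\lambda)$ lies in $\mathcal O^{\mathcal H}$ if and only if $\mathcal H'_\lambda\subset\mathcal H_V$, if and only if $\mathbb M(\lambda,\mathcal H_V)\in\mathcal O^{\mathcal H}$. -/

import Mathlib

universe u v w

noncomputable section

namespace HigherOrderO

/-- The universal enveloping algebra `U𝔤`. A `𝔤`-module is treated throughout as a left
`U𝔤`-module (whose complex vector space structure is the one coming from `ℂ → U𝔤`). -/
abbrev Ug (𝔤 : Type u) [LieRing 𝔤] [LieAlgebra ℂ 𝔤] : Type u :=
  UniversalEnvelopingAlgebra ℂ 𝔤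

/-- The canonical map `𝔤 → U𝔤`. -/
abbrev toU {𝔤 : Type u} [LieRing 𝔤] [LieAlgebra ℂ 𝔤] (x : 𝔤) : Ug 𝔤 :=
  UniversalEnvelopingAlgebra.ι ℂ x

variable {𝔤 : Type u} [LieRing 𝔤] [LieAlgebra ℂ 𝔤] {𝔥 : LieSubalgebra ℂ 𝔤}

/-! ### Combinatorics of the Dynkin diagram and of a weight

The Chevalley generators are `b.e i`, `b.f i`, the simple coroots are `b.h' i`, and
`b.A i j` is the value of the `i`-th simple root on the `j`-th simple coroot. -/

/-- `Indep(I)`: the sets of nodes of the Dynkin diagram that have no edge between them. -/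
def Indep {ι : Type v} [Finite ι] (b : LieAlgebra.Basis ι 𝔥) : Set (Finset ι) :=
  {H | ∀ i ∈ H, ∀ j ∈ H, i ≠ j → b.A i j = 0}

open Classical in
/-- `J_λ = {i ∈ I : ⟨λ, αᵢ^∨⟩ ∈ ℤ_{≥ 0}}`. -/
def integrability {ι : Type v} [Fintype ι] (b : LieAlgebra.Basis ι 𝔥)
    (lam : Module.Dual ℂ 𝔥) : Finset ι :=
  Finset.univ.filter fun i => ∃ n : ℕ, lam (b.h' i) = (n : ℂ)

/-- The natural number `⟨λ, αᵢ^∨⟩`, for `i ∈ J_λ` (see `pairingNat_eq`); the value for other `i`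
is never used. -/
def pairingNat {ι : Type v} [Finite ι] (b : LieAlgebra.Basis ι 𝔥)
    (lam : Module.Dual ℂ 𝔥) (i : ι) : ℕ :=
  ⌊(lam (b.h' i)).re⌋₊

theorem pairingNat_eq {ι : Type v} [Fintype ι] (b : LieAlgebra.Basis ι 𝔥)
    (lam : Module.Dual ℂ 𝔥) {i : ι} (hi : i ∈ integrability b lam) :
    (pairingNat b lam i : ℂ) = lam (b.h' i) := by
  obtain ⟨n, hn⟩ : ∃ n : ℕ, lam (b.h' i) = (n : ℂ) := by simpa [integrability] using hi
  simp [pairingNat, hn]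

/-- `𝓗^min`: the inclusion-minimal members of `𝓗`. -/
def minimalHoles {ι : Type v} (ℋ : Set (Finset ι)) : Set (Finset ι) :=
  {H | Minimal (· ∈ ℋ) H}

/-- `𝓗'_λ = {J_λ ∩ H : H ∈ 𝓗^min}`. -/
def restrictedHoles {ι : Type v} [Fintype ι] [DecidableEq ι] (b : LieAlgebra.Basis ι 𝔥)
    (lam : Module.Dual ℂ 𝔥) (ℋ : Set (Finset ι)) : Set (Finset ι) :=
  (fun H => integrability b lam ∩ H) '' minimalHoles ℋ

/-! ### Products of lowering operators -/

/-- `∏_{h ∈ H} f_h ^ {n h}` in `U𝔤`. The set `H` is listed in some order; for `H ∈ Indep(I)`, the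
only case used, the order does not matter (see `fProd_eq`). -/
def fProd {ι : Type v} [Finite ι] (b : LieAlgebra.Basis ι 𝔥) (H : Finset ι) (n : ι → ℕ) : Ug 𝔤 :=
  (H.toList.map fun h => toU (b.f h) ^ n h).prod

/-- Lowering operators at nodes which are not joined commute. -/
theorem lie_f_f_eq_zero [FiniteDimensional ℂ 𝔤] {ι : Type v} [Finite ι]
    (b : LieAlgebra.Basis ι 𝔥) {i j : ι} (hij : i ≠ j) (hA : b.A j i = 0) :
    ⁅b.f i, b.f j⁆ = 0 := by
  have P : (b.sl2 i).HasPrimitiveVectorWith (b.f j) (0 : ℂ) :=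
    { ne_zero := (b.sl2 j).f_ne_zero
      lie_h := by rw [b.lie_h_f, hA]; simp
      lie_e := b.lie_e_f_ne i j hij }
  simpa using P.pow_toEnd_f_eq_zero_of_eq_nat (n := 0) (by simp)

theorem fProd_eq [FiniteDimensional ℂ 𝔤] {ι : Type v} [Finite ι]
    (b : LieAlgebra.Basis ι 𝔥) {H : Finset ι} (hH : H ∈ Indep b) (n : ι → ℕ)
    {l : List ι} (hl : l.Perm H.toList) :
    fProd b H n = (l.map fun h => toU (b.f h) ^ n h).prod := by
  refine ((hl.map _).prod_eq' ?_).symm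
  have hn : l.Nodup := hl.nodup_iff.mpr H.nodup_toList
  have hc : ∀ x ∈ l, ∀ y ∈ l, x ≠ y →
      Commute (toU (b.f x) ^ n x) (toU (b.f y) ^ n y) := by
    intro x hx y hy hxy
    have h0 := lie_f_f_eq_zero b hxy
      (hH y (by simpa using hl.subset hy) x (by simpa using hl.subset hx) hxy.symm)
    refine Commute.pow_pow ?_ _ _
    let : LieRing (Ug 𝔤) := LieRing.ofAssociativeRing
    have := LieHom.map_lie (UniversalEnvelopingAlgebra.ι ℂ) (b.f x) (b.f y)
    rw [h0, map_zero, LieRing.of_associative_ring_bracket] at this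
    exact (sub_eq_zero.mp this.symm)
  rw [List.pairwise_map]
  exact hn.imp_of_mem fun hx hy hxy => hc _ hx _ hy hxy

/-- `∏_{h ∈ H} f_h ^ {⟨λ, α_h^∨⟩ + 1}`, for independent `H ⊆ J_λ`. -/
def fHole {ι : Type v} [Finite ι] (b : LieAlgebra.Basis ι 𝔥) (lam : Module.Dual ℂ 𝔥)
    (H : Finset ι) : Ug 𝔤 :=
  fProd b H fun h => pairingNat b lam h + 1

/-! ### Highest weight modules -/

/-- The weight space `V_μ = {v : h v = μ(h) v for all h ∈ 𝔥}`. -/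
def weightSpace (V : Type w) [AddCommGroup V] [Module ℂ V] [Module (Ug 𝔤) V]
    [IsScalarTower ℂ (Ug 𝔤) V] (mu : Module.Dual ℂ 𝔥) : Submodule ℂ V where
  carrier := {v | ∀ h : 𝔥, toU (h : 𝔤) • v = mu h • v}
  zero_mem' := by simp
  add_mem' := fun ha hb h => by rw [smul_add, smul_add, ha h, hb h]
  smul_mem' := fun c v hv h => by
    have : SMulCommClass ℂ (Ug 𝔤) V := IsScalarTower.to_smulCommClass
    rw [← smul_comm c, hv h, smul_comm]

/-- The left ideal of `U𝔤` generated by `𝔫⁺` (equivalently, by all `eᵢ`) and by all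
`h - λ(h)`, `h ∈ 𝔥`. -/
def vermaIdeal {ι : Type v} [Finite ι] (b : LieAlgebra.Basis ι 𝔥) (lam : Module.Dual ℂ 𝔥) :
    Submodule (Ug 𝔤) (Ug 𝔤) :=
  Submodule.span (Ug 𝔤)
    (Set.range (fun i => toU (b.e i)) ∪
      Set.range (fun h : 𝔥 => toU (h : 𝔤) - algebraMap ℂ (Ug 𝔤) (lam h)))

/-- The Verma module `M(λ)`. -/
abbrev Verma {ι : Type v} [Finite ι] (b : LieAlgebra.Basis ι 𝔥) (lam : Module.Dual ℂ 𝔥) :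
    Type u :=
  Ug 𝔤 ⧸ vermaIdeal b lam

/-- The simple module `L(λ)`: the quotient of `M(λ)` by the sum of its proper submodules. -/
abbrev Simple {ι : Type v} [Finite ι] (b : LieAlgebra.Basis ι 𝔥) (lam : Module.Dual ℂ 𝔥) :
    Type u :=
  Verma b lam ⧸ sSup {N : Submodule (Ug 𝔤) (Verma b lam) | N ≠ ⊤}

/-- The submodule `∑_{H ∈ 𝓗^min} U𝔤 (∏_{h ∈ J_λ ∩ H} f_h ^ {⟨λ, α_h^∨⟩ + 1}) M(λ)_λ`
of `M(λ)`. -/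
def holesSubmodule {ι : Type v} [Fintype ι] [DecidableEq ι] (b : LieAlgebra.Basis ι 𝔥)
    (lam : Module.Dual ℂ 𝔥) (ℋ : Set (Finset ι)) : Submodule (Ug 𝔤) (Verma b lam) :=
  ⨆ H ∈ minimalHoles ℋ, Submodule.span (Ug 𝔤)
    ((fun v : Verma b lam => fHole b lam (integrability b lam ∩ H) • v) ''
      (weightSpace (Verma b lam) lam : Set (Verma b lam)))

/-- The higher order Verma module `𝕄(λ, 𝓗)`. -/
abbrev HigherVerma {ι : Type v} [Fintype ι] [DecidableEq ι] (b : LieAlgebra.Basis ι 𝔥)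
    (lam : Module.Dual ℂ 𝔥) (ℋ : Set (Finset ι)) : Type u :=
  Verma b lam ⧸ holesSubmodule b lam ℋ

/-- `𝓗_V`, for a quotient `V` of `M(λ)`: the independent `H ⊆ J_λ` for which
`(∏_{h ∈ H} f_h ^ {⟨λ, α_h^∨⟩ + 1}) V_λ = 0`. -/
def holes {ι : Type v} [Fintype ι] (b : LieAlgebra.Basis ι 𝔥) (lam : Module.Dual ℂ 𝔥)
    (V : Type w) [AddCommGroup V] [Module ℂ V] [Module (Ug 𝔤) V] [IsScalarTower ℂ (Ug 𝔤) V] :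
    Set (Finset ι) :=
  {H | H ∈ Indep b ∧ H ⊆ integrability b lam ∧
    ∀ v ∈ weightSpace V lam, fHole b lam H • v = 0}

/-! ### The categories `𝒪` and `𝒪^𝓗` -/

/-- The image of `U𝔫⁺` in `U𝔤`. -/
def Uplus {ι : Type v} [Finite ι] (b : LieAlgebra.Basis ι 𝔥) : Subalgebra ℂ (Ug 𝔤) :=
  Algebra.adjoin ℂ (Set.range fun i => toU (b.e i))

/-- `V` is an object of category `𝒪`: finitely generated over `U𝔤`, the sum of its weight
spaces, and locally `𝔫⁺`-finite. -/
structure MemO {ι : Type v} [Finite ι] (b : LieAlgebra.Basis ι 𝔥) (V : Type w) [AddCommGroup V]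
    [Module ℂ V] [Module (Ug 𝔤) V] [IsScalarTower ℂ (Ug 𝔤) V] : Prop where
  finite : Module.Finite (Ug 𝔤) V
  weight : ⨆ mu : Module.Dual ℂ 𝔥, weightSpace V mu = ⊤
  locallyFinite : ∀ v : V, FiniteDimensional ℂ
    (Submodule.span ℂ {x : V | ∃ a ∈ Uplus b, x = a • v})

/-- `V` is an object of `𝒪^𝓗`: an object of `𝒪` on which `∏_{h ∈ H} f_h` acts locally
nilpotently for every `H ∈ 𝓗`. -/
structure MemOH {ι : Type v} [Finite ι] (b : LieAlgebra.Basis ι 𝔥) (ℋ : Set (Finset ι))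
    (V : Type w) [AddCommGroup V] [Module ℂ V] [Module (Ug 𝔤) V]
    [IsScalarTower ℂ (Ug 𝔤) V] : Prop where
  memO : MemO b V
  locallyNilpotent : ∀ H ∈ ℋ, ∀ v : V, ∃ n : ℕ, fProd b H (fun _ => 1) ^ n • v = 0

/-- `p : P → L(λ)` is a universal highest weight cover of `L(λ)` in `𝒪^𝓗`: `P` is a highest
weight module in `𝒪^𝓗`, `p` is surjective, and `p` factors uniquely, through a surjection,
over every surjection onto `L(λ)` from a module of highest weight `λ` in `𝒪^𝓗`. -/
structure IsUniversalCover {ι : Type v} [Finite ι] (b : LieAlgebra.Basis ι 𝔥)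
    (ℋ : Set (Finset ι)) (lam : Module.Dual ℂ 𝔥)
    (P : Type u) [AddCommGroup P] [Module ℂ P] [Module (Ug 𝔤) P] [IsScalarTower ℂ (Ug 𝔤) P]
    (p : P →ₗ[Ug 𝔤] Simple b lam) : Prop where
  highestWeight : ∃ pi : Verma b lam →ₗ[Ug 𝔤] P, Function.Surjective pi
  memOH : MemOH b ℋ P
  surjective : Function.Surjective p
  universal : ∀ (V : Type w) [AddCommGroup V] [Module ℂ V] [Module (Ug 𝔤) V]
    [IsScalarTower ℂ (Ug 𝔤) V],
    (∃ pi : Verma b lam →ₗ[Ug 𝔤] V, Function.Surjective pi) → MemOH b ℋ V →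
    ∀ q : V →ₗ[Ug 𝔤] Simple b lam, Function.Surjective q →
      ∃ g : P →ₗ[Ug 𝔤] V, Function.Surjective g ∧ q ∘ₗ g = p ∧
        ∀ g' : P →ₗ[Ug 𝔤] V, q ∘ₗ g' = p → g' = g

end HigherOrderO

end

/-!
Everything rests on a criterion for modules generated by one vector `v` of highest weight `λ`
(`IsHighestWeightVector.memOH_iff`): such a module lies in `𝒪^ℋ` if and only if
`∏_{h ∈ J_λ ∩ H} f_h ^ (⟨λ, α_h^∨⟩ + 1)` kills `v` for every minimal `H ∈ ℋ`.

* If a power of `∏_{h ∈ H} f_h` kills `v`, the `𝔰𝔩₂`-triples at the nodes of `H` can be treated one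
  at a time, since `H` spans no edge. Applying `e_h` lowers the exponent of `f_h` as long as the
  coefficient `(m + 1) (⟨λ, α_h^∨⟩ - m)` does not vanish: down to `⟨λ, α_h^∨⟩ + 1` for `h ∈ J_λ`,
  and down to `0` for the other `h` (`fHole_smul_eq_zero_of_fProd_smul_eq_zero`).
* Conversely, some power of `∏ f_h` then kills `v`. As the `f_h` commute and are `ad`-nilpotent,
  their product is locally `ad`-nilpotent on generators of `U𝔤`, so the vectors killed by one of its
  powers form a submodule (`exists_fProd_one_pow_smul_smul_eq_zero`).

The criterion is applied to `L(λ)`, to `𝕄(λ, ℋ)` and to an arbitrary quotient of `M(λ)`. Two facts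
about highest weight modules are needed besides. First, the highest weight space is a line and proper
submodules avoid it; this follows by grading with an element `ρ^∨` of the Cartan subalgebra at which
all simple roots equal `1` (`rhoCheck`, `lowerPart`). Second, `M(λ) ≠ 0`.

For the second, no Poincaré–Birkhoff–Witt theorem is used. The vector space on the words in the
letters `f_i` carries operators satisfying the Chevalley relations, with the empty word as a vector
of highest weight `λ`. The Lie algebra generated by the pairs (operator, Chevalley generator) maps
onto `𝔤` (`wordCover`), and it has a triangular decomposition, compatible with that of `𝔤`. So an
element of the kernel has no component in the Cartan subalgebra and sends the empty word to a
combination of nonempty words (`coverAct_single_nil_mem`). The submodule which the kernel generates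
therefore does not contain the empty word, and `𝔤` acts on the quotient, which is a nonzero quotient
of `M(λ)` (`vermaIdeal_ne_top`).
-/

noncomputable section

namespace HigherOrderO

variable {𝔤 : Type u} [LieRing 𝔤] [LieAlgebra ℂ 𝔤] {𝔥 : LieSubalgebra ℂ 𝔤}

/-! ### Commutation in the enveloping algebra -/

/-- The canonical map `𝔤 → U𝔤` as a linear map. -/
def toULinear : 𝔤 →ₗ[ℂ] Ug 𝔤 :=
  letI : LieRing (Ug 𝔤) := LieRing.ofAssociativeRing
  (UniversalEnvelopingAlgebra.ι ℂ : 𝔤 →ₗ⁅ℂ⁆ Ug 𝔤)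

theorem toU_eq (x : 𝔤) : toU x = toULinear x := rfl

theorem toU_mul (x y : 𝔤) : toU x * toU y = toU y * toU x + toU ⁅x, y⁆ := by
  let : LieRing (Ug 𝔤) := LieRing.ofAssociativeRing
  have := LieHom.map_lie (UniversalEnvelopingAlgebra.ι ℂ) x y
  rw [LieRing.of_associative_ring_bracket] at this
  change _ = _ + UniversalEnvelopingAlgebra.ι ℂ ⁅x, y⁆
  rw [this]
  abel

theorem commute_toU {x y : 𝔤} (h : ⁅x, y⁆ = 0) : Commute (toU x) (toU y) := by
  have := toU_mul x y
  rwa [h, toU_eq 0, map_zero, add_zero] at this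

/-- `U𝔤` is generated by any set of Lie generators of `𝔤`. -/
theorem adjoin_toU_eq_top {s : Set 𝔤} (hs : LieSubalgebra.lieSpan ℂ 𝔤 s = ⊤) :
    Algebra.adjoin ℂ (toU '' s) = (⊤ : Subalgebra ℂ (Ug 𝔤)) := by
  set S := Algebra.adjoin ℂ (toU '' s) with hS
  have hmem : ∀ x : 𝔤, toU x ∈ S := by
    intro x
    have hx : x ∈ LieSubalgebra.lieSpan ℂ 𝔤 s := by rw [hs]; trivial
    induction hx using LieSubalgebra.lieSpan_induction with
    | mem u hu => exact Algebra.subset_adjoin ⟨u, hu, rfl⟩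
    | zero => rw [toU_eq, map_zero]; exact S.zero_mem
    | add u v _ _ hu hv => rw [toU_eq, map_add]; exact add_mem hu hv
    | smul t u _ hu => rw [toU_eq, map_smul]; exact S.smul_mem hu t
    | lie u v _ _ hu hv =>
      have : toU ⁅u, v⁆ = toU u * toU v - toU v * toU u := by rw [toU_mul]; abel
      rw [this]
      exact sub_mem (mul_mem hu hv) (mul_mem hv hu)
  let : LieRing (Ug 𝔤) := LieRing.ofAssociativeRing
  let : LieRing S := LieRing.ofAssociativeRing
  -- A subalgebra containing the image of `𝔤` is everything, by the universal property.
  let g : 𝔤 →ₗ⁅ℂ⁆ S :=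
    { toFun := fun x => ⟨toU x, hmem x⟩
      map_add' := fun x y => by ext; exact map_add toULinear x y
      map_smul' := fun c x => by ext; exact map_smul toULinear c x
      map_lie' := fun {x y} => by
        ext
        simp only [LieRing.of_associative_ring_bracket]
        push_cast
        rw [toU_mul x y]; abel }
  have hid : S.val.comp (UniversalEnvelopingAlgebra.lift ℂ g) = AlgHom.id ℂ _ := by
    ext x
    change ((UniversalEnvelopingAlgebra.lift ℂ g) (UniversalEnvelopingAlgebra.ι ℂ x) : Ug 𝔤) = _
    rw [UniversalEnvelopingAlgebra.lift_ι_apply]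
    rfl
  rw [eq_top_iff]
  intro a _
  have := congrArg (fun φ => φ a) hid
  simp only [AlgHom.comp_apply, AlgHom.id_apply] at this
  rw [← this]
  exact Subtype.property _

section Module

variable {V : Type w} [AddCommGroup V] [Module ℂ V] [Module (Ug 𝔤) V] [IsScalarTower ℂ (Ug 𝔤) V]

theorem smulCommClass_Ug : SMulCommClass ℂ (Ug 𝔤) V := IsScalarTower.to_smulCommClass

theorem smul_smul_comm (c : ℂ) (a : Ug 𝔤) (y : V) : a • c • y = c • a • y :=
  (smulCommClass_Ug.smul_comm c a y).symm

omit [Module ℂ V] [IsScalarTower ℂ (Ug 𝔤) V] in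
theorem toU_smul_toU_smul (x y : 𝔤) (m : V) :
    toU x • toU y • m = toU y • toU x • m + toU ⁅x, y⁆ • m := by
  rw [smul_smul, toU_mul, add_smul, mul_smul]

/-- A complex subspace stable under Lie generators of `𝔤` is stable under `U𝔤`. -/
theorem smul_mem_of_generators {s : Set 𝔤} (hs : LieSubalgebra.lieSpan ℂ 𝔤 s = ⊤)
    (N : Submodule ℂ V) (hN : ∀ x ∈ s, ∀ y ∈ N, toU x • y ∈ N) (a : Ug 𝔤) {y : V} (hy : y ∈ N) :
    a • y ∈ N := by
  have ha : a ∈ Algebra.adjoin ℂ (toU '' s) := by rw [adjoin_toU_eq_top hs]; trivial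
  induction ha using Algebra.adjoin_induction generalizing y with
  | mem x hx => obtain ⟨x, hx, rfl⟩ := hx; exact hN x hx y hy
  | algebraMap r => rw [algebraMap_smul]; exact N.smul_mem r hy
  | add a b _ _ ha hb => rw [add_smul]; exact N.add_mem (ha hy) (hb hy)
  | mul a b _ _ ha hb => rw [mul_smul]; exact ha (hb hy)

/-! ### The action of an `𝔰𝔩₂`-triple -/

variable {ι : Type v} [Finite ι] (b : LieAlgebra.Basis ι 𝔥)

theorem toU_h_smul_f_pow_smul (i : ι) {y : V} {c : ℂ} (hh : toU (b.h i) • y = c • y) (m : ℕ) :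
    toU (b.h i) • toU (b.f i) ^ m • y = (c - 2 * m) • toU (b.f i) ^ m • y := by
  induction m with
  | zero => simpa using hh
  | succ m ih =>
    rw [pow_succ', mul_smul, toU_smul_toU_smul, (b.sl2 i).lie_lie_smul_f ℂ, ih, toU_eq (-_), map_neg,
      map_smul, ← toU_eq, neg_smul, smul_assoc, smul_smul_comm]
    generalize toU (b.f i) • toU (b.f i) ^ m • y = z
    push_cast
    module

theorem toU_e_smul_f_pow_succ_smul (i : ι) {y : V} {c : ℂ} (he : toU (b.e i) • y = 0)
    (hh : toU (b.h i) • y = c • y) (m : ℕ) :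
    toU (b.e i) • toU (b.f i) ^ (m + 1) • y = ((m + 1) * (c - m)) • toU (b.f i) ^ m • y := by
  induction m with
  | zero =>
    rw [zero_add, pow_one, toU_smul_toU_smul, he, (b.sl2 i).lie_e_f, hh]
    simp
  | succ m ih =>
    rw [pow_succ', mul_smul, toU_smul_toU_smul, (b.sl2 i).lie_e_f, ih,
      toU_h_smul_f_pow_smul b i hh, smul_smul_comm, ← mul_smul (toU (b.f i)), ← pow_succ']
    generalize toU (b.f i) ^ (m + 1) • y = z
    push_cast
    module

/-- If some power of `f` kills a singular vector of weight `c`, then already `f ^ (n + 1)` does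
when `c = n` is a natural number, and the vector is zero otherwise. -/
theorem f_pow_smul_eq_zero_descent (i : ι) {y : V} {c : ℂ} (he : toU (b.e i) • y = 0)
    (hh : toU (b.h i) • y = c • y) {m : ℕ} (hm : toU (b.f i) ^ m • y = 0) :
    (∀ n : ℕ, c = n → toU (b.f i) ^ (n + 1) • y = 0) ∧ ((∀ n : ℕ, c ≠ n) → y = 0) := by
  induction m with
  | zero =>
    rw [pow_zero, one_smul] at hm
    simp [hm]
  | succ m ih =>
    by_cases hc : c = m
    · refine ⟨fun n hn => ?_, fun h => absurd hc (h m)⟩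
      have : n = m := by exact_mod_cast hn.symm.trans hc
      rwa [this]
    · apply ih
      have := toU_e_smul_f_pow_succ_smul b i he hh m
      rw [hm, smul_zero, eq_comm, smul_eq_zero] at this
      refine this.resolve_left (mul_ne_zero (Nat.cast_add_one_ne_zero m) (sub_ne_zero.mpr hc))

/-! ### Products of commuting lowering operators -/

theorem commute_e_f {i j : ι} (hij : i ≠ j) : Commute (toU (b.e i)) (toU (b.f j)) :=
  commute_toU (b.lie_e_f_ne i j hij)

theorem commute_h_f {i j : ι} (hA : b.A j i = 0) : Commute (toU (b.h i)) (toU (b.f j)) :=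
  commute_toU (by rw [b.lie_h_f, hA]; simp)

theorem commute_f_f [FiniteDimensional ℂ 𝔤] {i j : ι} (hA : i ≠ j → b.A j i = 0) :
    Commute (toU (b.f i)) (toU (b.f j)) := by
  by_cases hij : i = j
  · rw [hij]
  · exact commute_toU (lie_f_f_eq_zero b hij (hA hij))

theorem commute_fProd {H : Finset ι} {n : ι → ℕ} {a : Ug 𝔤}
    (h : ∀ i ∈ H, Commute a (toU (b.f i))) : Commute a (fProd b H n) := by
  unfold fProd
  refine Commute.list_prod_right _ _ fun x hx => ?_
  obtain ⟨i, hi, rfl⟩ := List.mem_map.mp hx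
  exact (h i (by simpa using hi)).pow_right _

theorem indep_mono {H K : Finset ι} (hH : H ∈ Indep b) (hK : K ⊆ H) : K ∈ Indep b :=
  fun i hi j hj hij => hH i (hK hi) j (hK hj) hij

theorem commute_h_fProd [DecidableEq ι] {i : ι} {H : Finset ι} (hi : i ∉ H) (hH : insert i H ∈ Indep b)
    (n : ι → ℕ) : Commute (toU (b.h i)) (fProd b H n) :=
  commute_fProd b fun j hj => commute_h_f b <|
    hH j (by simp [hj]) i (by simp) (by rintro rfl; exact hi hj)

theorem commute_e_fProd {i : ι} {H : Finset ι} (hi : i ∉ H) (n : ι → ℕ) :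
    Commute (toU (b.e i)) (fProd b H n) :=
  commute_fProd b fun j hj => commute_e_f b (by rintro rfl; exact hi hj)

@[simp]
theorem fProd_empty (n : ι → ℕ) : fProd b ∅ n = 1 := by simp [fProd]

section

variable [FiniteDimensional ℂ 𝔤] [DecidableEq ι]

theorem fProd_insert {i : ι} {H : Finset ι} (hi : i ∉ H) (hH : insert i H ∈ Indep b)
    (n : ι → ℕ) : fProd b (insert i H) n = toU (b.f i) ^ n i * fProd b H n := by
  rw [fProd_eq b hH n (l := i :: H.toList) (Finset.toList_insert hi).symm]
  simp [fProd]

theorem commute_f_fProd {i : ι} {H : Finset ι} (hH : insert i H ∈ Indep b) (n : ι → ℕ) :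
    Commute (toU (b.f i)) (fProd b H n) :=
  commute_fProd b fun j hj => commute_f_f b fun hij =>
    hH j (by simp [hj]) i (by simp) hij.symm

theorem fProd_one_pow {H : Finset ι} (hH : H ∈ Indep b) (N : ℕ) :
    fProd b H (fun _ => 1) ^ N = fProd b H fun _ => N := by
  induction H using Finset.induction_on with
  | empty => simp
  | insert i H hi ih =>
    rw [fProd_insert b hi hH, fProd_insert b hi hH, pow_one,
      (commute_f_fProd b hH _).mul_pow, ih (indep_mono b hH (Finset.subset_insert i H))]

/-- Products of lowering operators with smaller exponents divide those with larger ones. -/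
theorem exists_fProd_eq_mul {H K : Finset ι} (hH : H ∈ Indep b) (hK : K ⊆ H) {m n : ι → ℕ}
    (hnm : ∀ i ∈ K, n i ≤ m i) : ∃ a, fProd b H m = a * fProd b K n := by
  induction H using Finset.induction_on generalizing K with
  | empty => exact ⟨1, by simp [Finset.subset_empty.mp hK]⟩
  | insert i H hi ih =>
    have hH' := indep_mono b hH (Finset.subset_insert i H)
    by_cases hiK : i ∈ K
    · obtain ⟨a, ha⟩ := ih hH' (K := K.erase i) (by grind) (fun j hj => hnm j (by grind))
      have hKI : insert i (K.erase i) ∈ Indep b := indep_mono b hH (by grind)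
      refine ⟨a * toU (b.f i) ^ (m i - n i), ?_⟩
      conv_rhs => rw [← Finset.insert_erase hiK, fProd_insert b (by simp) hKI]
      rw [fProd_insert b hi hH, ((commute_f_fProd b hH m).pow_left _).eq, ha, mul_assoc,
        ← ((commute_f_fProd b hKI n).pow_left _).eq, mul_assoc, ← mul_assoc (_ ^ _) (_ ^ _),
        ← pow_add, Nat.sub_add_cancel (hnm i hiK)]
    · obtain ⟨a, ha⟩ := ih hH' (K := K) (by grind) hnm
      exact ⟨toU (b.f i) ^ m i * a, by rw [fProd_insert b hi hH, ha, mul_assoc]⟩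

end

end Module

/-! ### Locally nilpotent action -/

section LocallyNilpotent

variable {A : Type*} [Ring A] [Algebra ℂ A]

/-- The inner derivation `x ↦ f x - x f`. -/
def adOp (f : A) : Module.End ℂ A := LinearMap.mulLeft ℂ f - LinearMap.mulRight ℂ f

@[simp]
theorem adOp_apply (f x : A) : adOp f x = f * x - x * f := rfl

theorem pow_add_smul_smul_eq_zero {V : Type*} [AddCommGroup V] [Module A V] {f : A} (K n : ℕ)
    {x : A} {v : V} (hx : (adOp f ^ K) x = 0) (hv : f ^ n • v = 0) :
    f ^ (K + n) • x • v = 0 := by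
  -- Induction on `K + n` through `f (x v) = [f, x] v + x (f v)`.
  induction hN : K + n generalizing K n x v with
  | zero =>
    obtain ⟨rfl, rfl⟩ : K = 0 ∧ n = 0 := by omega
    rw [pow_zero, one_smul] at hv
    simp [hv]
  | succ N ih =>
    rcases K with - | K
    · have : x = 0 := by simpa using hx
      simp [this]
    rcases n with - | n
    · have : v = 0 := by simpa using hv
      simp [this]
    have h1 := ih K (n + 1) (x := adOp f x) (v := v) (by rwa [pow_succ] at hx) hv (by omega)
    have h2 := ih (K + 1) n (x := x) (v := f • v) hx
      (by rwa [pow_succ, mul_smul] at hv) (by omega)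
    have h3 : f • x • v = (adOp f x) • v + x • f • v := by
      rw [adOp_apply, sub_smul, mul_smul, mul_smul]; abel
    rw [pow_succ, mul_smul, h3, smul_add, h1, h2, add_zero]

/-- If two commuting operators have powers killing `x`, so has their sum. -/
theorem add_pow_apply_eq_zero_of_commute {M : Type*} [AddCommGroup M] [Module ℂ M]
    {S T : Module.End ℂ M} (h : Commute S T) {x : M} {m n : ℕ} (hS : (S ^ m) x = 0)
    (hT : (T ^ n) x = 0) : ((S + T) ^ (m + n)) x = 0 := by
  rw [h.add_pow, LinearMap.sum_apply]
  refine Finset.sum_eq_zero fun k _ => ?_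
  rw [← (Nat.cast_commute _ _).eq]
  have : (S ^ k * T ^ (m + n - k)) x = 0 := by
    rcases le_total m k with hk | hk
    · rw [(h.pow_pow _ _).eq, ← Nat.sub_add_cancel hk, pow_add, ← mul_assoc,
        Module.End.mul_apply, hS, map_zero]
    · rw [show m + n - k = (m - k) + n by omega, pow_add, ← mul_assoc, Module.End.mul_apply, hT,
        map_zero]
  rw [Module.End.mul_apply, this, map_zero]

theorem exists_adOp_mul_pow_eq_zero {f g x : A} (hfg : Commute f g) {m n : ℕ}
    (hf : (adOp f ^ m) x = 0) (hg : (adOp g ^ n) x = 0) :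
    ∃ k, (adOp (f * g) ^ k) x = 0 := by
  have hdecomp : adOp (f * g) =
      LinearMap.mulLeft ℂ f * adOp g + LinearMap.mulRight ℂ g * adOp f := by
    ext y
    simp only [adOp_apply, LinearMap.add_apply, Module.End.mul_apply, LinearMap.mulLeft_apply,
      LinearMap.mulRight_apply, hfg.eq]
    rw [← hfg.eq]
    noncomm_ring
  have hLL : Commute (LinearMap.mulLeft ℂ f) (LinearMap.mulLeft ℂ g) := by
    ext y; simp [← mul_assoc, hfg.eq]
  have hRR : Commute (LinearMap.mulRight ℂ f) (LinearMap.mulRight ℂ g) := by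
    ext y; simp [mul_assoc, hfg.eq]
  have hLR : ∀ a b : A, Commute (LinearMap.mulLeft ℂ a) (LinearMap.mulRight ℂ b) :=
    fun a b => LinearMap.commute_mulLeft_right a b
  have hLg : Commute (LinearMap.mulLeft ℂ f) (adOp g) := hLL.sub_right (hLR _ _)
  have hRf : Commute (LinearMap.mulRight ℂ g) (adOp f) := (hLR _ _).symm.sub_right hRR.symm
  have hadad : Commute (adOp g) (adOp f) :=
    (hLL.symm.sub_right (hLR _ _)).sub_left ((hLR _ _).symm.sub_right hRR.symm)
  have hgg : Commute (adOp g) (LinearMap.mulRight ℂ g) := (hLR _ _).sub_left (Commute.refl _)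
  have hff : Commute (LinearMap.mulLeft ℂ f) (adOp f) := (Commute.refl _).sub_right (hLR _ _)
  refine ⟨n + m, ?_⟩
  rw [hdecomp]
  refine add_pow_apply_eq_zero_of_commute ?_ ?_ ?_
  · exact ((hLR _ _).mul_right hff).mul_left (hgg.mul_right hadad)
  · rw [hLg.mul_pow, Module.End.mul_apply, hg, map_zero]
  · rw [hRf.mul_pow, Module.End.mul_apply, hf, map_zero]

end LocallyNilpotent

section

variable {ι : Type v} [Finite ι] (b : LieAlgebra.Basis ι 𝔥)

theorem adOp_toU_pow_toU (x y : 𝔤) (n : ℕ) :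
    (adOp (toU x) ^ n) (toU y) = toU ((LieAlgebra.ad ℂ 𝔤 x ^ n) y) := by
  induction n with
  | zero => rfl
  | succ n ih =>
    rw [pow_succ', Module.End.mul_apply, ih, pow_succ', Module.End.mul_apply, adOp_apply, toU_mul,
      LieAlgebra.ad_apply]
    abel

/-- `ad fᵢ` is nilpotent on `𝔤`. -/
theorem exists_ad_f_pow_eq_zero [FiniteDimensional ℂ 𝔤] (i : ι) (x : 𝔤) :
    ∃ n, (LieAlgebra.ad ℂ 𝔤 (b.f i) ^ n) x = 0 := by
  suffices h : LieSubalgebra.engel ℂ (b.f i) = ⊤ by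
    rw [← LieSubalgebra.mem_engel_iff, h]; trivial
  rw [eq_top_iff, ← b.span_ef, LieSubalgebra.lieSpan_le]
  rintro - (⟨j, rfl⟩ | ⟨j, rfl⟩) <;> rw [SetLike.mem_coe, LieSubalgebra.mem_engel_iff]
  · by_cases hij : j = i
    · subst hij
      refine ⟨3, ?_⟩
      have h1 : ⁅b.f j, b.e j⁆ = -b.h j := by rw [← lie_skew, (b.sl2 j).lie_e_f]
      have h2 : ⁅b.f j, b.h j⁆ = 2 • b.f j := by
        rw [← lie_skew, (b.sl2 j).lie_h_f_nsmul, neg_neg]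
      simp [pow_succ', h1, h2]
    · refine ⟨1, ?_⟩
      rw [pow_one, LieAlgebra.ad_apply, ← lie_skew, b.lie_e_f_ne j i hij, neg_zero]
  · by_cases hij : i = j
    · subst hij
      exact ⟨1, by simp⟩
    · have P : (b.sl2 i).HasPrimitiveVectorWith (b.f j) (-(b.A j i : ℂ)) :=
        { ne_zero := (b.sl2 j).f_ne_zero
          lie_h := by rw [b.lie_h_f, ← Int.cast_smul_eq_zsmul ℂ]; push_cast; rfl
          lie_e := b.lie_e_f_ne i j hij }
      obtain ⟨n, hn⟩ := P.exists_nat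
      exact ⟨n + 1, P.pow_toEnd_f_eq_zero_of_eq_nat hn⟩

theorem exists_adOp_fProd_one_pow_eq_zero [FiniteDimensional ℂ 𝔤] [DecidableEq ι]
    {H : Finset ι} (hH : H ∈ Indep b) (x : 𝔤) :
    ∃ n, (adOp (fProd b H fun _ => 1) ^ n) (toU x) = 0 := by
  induction H using Finset.induction_on with
  | empty => exact ⟨1, by simp⟩
  | insert i H hi ih =>
    obtain ⟨n, hn⟩ := ih (indep_mono b hH (Finset.subset_insert i H))
    obtain ⟨m, hm⟩ := exists_ad_f_pow_eq_zero b i x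
    rw [fProd_insert b hi hH, pow_one]
    refine exists_adOp_mul_pow_eq_zero (commute_f_fProd b hH _) (m := m) ?_ hn
    rw [adOp_toU_pow_toU, hm, toU_eq, map_zero]

variable {V : Type w} [AddCommGroup V] [Module ℂ V] [Module (Ug 𝔤) V] [IsScalarTower ℂ (Ug 𝔤) V]

/-- The vectors killed by a power of `∏ f_h` form a submodule, because `ad (∏ f_h)` is locally
nilpotent. -/
theorem exists_fProd_one_pow_smul_smul_eq_zero [FiniteDimensional ℂ 𝔤] [DecidableEq ι]
    {H : Finset ι} (hH : H ∈ Indep b) {v : V} (hv : ∃ n, fProd b H (fun _ => 1) ^ n • v = 0)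
    (a : Ug 𝔤) : ∃ n, fProd b H (fun _ => 1) ^ n • a • v = 0 := by
  set F := fProd b H (fun _ => 1)
  let N : Submodule ℂ V :=
    { carrier := {v | ∃ n, F ^ n • v = 0}
      zero_mem' := ⟨0, by simp⟩
      add_mem' := by
        rintro x y ⟨m, hm⟩ ⟨n, hn⟩
        refine ⟨m + n, ?_⟩
        have hx : F ^ (m + n) • x = 0 := by rw [add_comm, pow_add, mul_smul, hm, smul_zero]
        have hy : F ^ (m + n) • y = 0 := by rw [pow_add, mul_smul, hn, smul_zero]
        rw [smul_add, hx, hy, add_zero]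
      smul_mem' := by
        rintro c x ⟨n, hn⟩
        exact ⟨n, by rw [smul_smul_comm, hn, smul_zero]⟩ }
  have huniv : LieSubalgebra.lieSpan ℂ 𝔤 Set.univ = ⊤ :=
    eq_top_iff.mpr fun x _ => LieSubalgebra.subset_lieSpan (Set.mem_univ x)
  refine smul_mem_of_generators huniv N ?_ a hv
  rintro x - y ⟨n, hn⟩
  obtain ⟨K, hK⟩ := exists_adOp_fProd_one_pow_eq_zero b hH x
  exact ⟨K + n, pow_add_smul_smul_eq_zero K n hK hn⟩

/-! ### Singular vectors -/

/-- A vector of weight `λ` killed by `𝔫⁺` (it may be zero). -/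
structure IsSingular (lam : Module.Dual ℂ 𝔥) (v : V) : Prop where
  e_smul : ∀ i, toU (b.e i) • v = 0
  h_smul : ∀ h : 𝔥, toU (h : 𝔤) • v = lam h • v

variable {b}

omit [IsScalarTower ℂ (Ug 𝔤) V] in
theorem IsSingular.h_i_smul {lam : Module.Dual ℂ 𝔥} {v : V} (hv : IsSingular b lam v) (i : ι) :
    toU (b.h i) • v = lam (b.h' i) • v := hv.h_smul (b.h' i)

theorem IsSingular.map {W : Type*} [AddCommGroup W] [Module ℂ W] [Module (Ug 𝔤) W]
    [IsScalarTower ℂ (Ug 𝔤) W] {lam : Module.Dual ℂ 𝔥} {v : V} (hv : IsSingular b lam v)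
    (φ : V →ₗ[Ug 𝔤] W) : IsSingular b lam (φ v) where
  e_smul i := by rw [← map_smul, hv.e_smul, map_zero]
  h_smul h := by
    rw [← map_smul, hv.h_smul, ← algebraMap_smul (Ug 𝔤), map_smul, algebraMap_smul]

end

section

variable {ι : Type v} [Fintype ι] [DecidableEq ι] (b : LieAlgebra.Basis ι 𝔥)
  {V : Type w} [AddCommGroup V] [Module ℂ V] [Module (Ug 𝔤) V] [IsScalarTower ℂ (Ug 𝔤) V]

omit [DecidableEq ι] in
theorem mem_integrability {lam : Module.Dual ℂ 𝔥} {i : ι} :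
    i ∈ integrability b lam ↔ ∃ n : ℕ, lam (b.h' i) = n := by simp [integrability]

/-- If a power of `∏_{h ∈ H} f_h` kills a singular vector, so does
`∏_{h ∈ J ∩ H} f_h ^ (⟨λ, α_h^∨⟩ + 1)`. The nodes of `H` are treated one at a time; the operators
at the other nodes preserve singularity for the `𝔰𝔩₂` at the given node. -/
theorem fHole_smul_eq_zero_of_fProd_smul_eq_zero [FiniteDimensional ℂ 𝔤]
    {lam : Module.Dual ℂ 𝔥} {H : Finset ι} (hH : H ∈ Indep b) (N : ι → ℕ) {y : V}
    (he : ∀ i ∈ H, toU (b.e i) • y = 0) (hh : ∀ i ∈ H, toU (b.h i) • y = lam (b.h' i) • y)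
    (hy : fProd b H N • y = 0) : fHole b lam (integrability b lam ∩ H) • y = 0 := by
  induction H using Finset.induction_on generalizing y with
  | empty => simpa [fHole] using hy
  | insert i H hi ih =>
    have hH' := indep_mono b hH (Finset.subset_insert i H)
    rw [fProd_insert b hi hH, mul_smul] at hy
    have hez : toU (b.e i) • fProd b H N • y = 0 := by
      rw [smul_smul, (commute_e_fProd b hi N).eq, mul_smul, he i (by simp), smul_zero]
    have hhz : toU (b.h i) • fProd b H N • y = lam (b.h' i) • fProd b H N • y := by
      rw [smul_smul, (commute_h_fProd b hi hH N).eq, mul_smul, hh i (by simp), smul_smul_comm]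
    obtain ⟨hnat, hnot⟩ := f_pow_smul_eq_zero_descent b i hez hhz hy
    by_cases hiJ : i ∈ integrability b lam
    · have hz := hnat (pairingNat b lam i) (pairingNat_eq b lam hiJ).symm
      rw [smul_smul, ((commute_f_fProd b hH N).pow_left _).eq, mul_smul] at hz
      rw [Finset.inter_insert_of_mem hiJ, fHole, fProd_insert b (by simp [hi])
        (indep_mono b hH (by grind)), ((commute_f_fProd b (indep_mono b hH (by grind)) _).pow_left
        _).eq, mul_smul]
      refine ih hH' (fun j hj => ?_) (fun j hj => ?_) hz
      · have hji : j ≠ i := by rintro rfl; exact hi hj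
        rw [smul_smul, ((commute_e_f b hji).pow_right _).eq, mul_smul, he j (by simp [hj]),
          smul_zero]
      · have hji : j ≠ i := by rintro rfl; exact hi hj
        rw [smul_smul, ((commute_h_f b (hH i (by simp) j (by simp [hj]) hji.symm)).pow_right
          _).eq, mul_smul, hh j (by simp [hj]), smul_smul_comm]
    · rw [Finset.inter_insert_of_notMem hiJ]
      refine ih hH' (fun j hj => he j (by simp [hj])) (fun j hj => hh j (by simp [hj]))
        (hnot fun n hn => hiJ ((mem_integrability b).mpr ⟨n, hn⟩))

theorem e_smul_fHole_smul [FiniteDimensional ℂ 𝔤] {lam : Module.Dual ℂ 𝔥} {K : Finset ι}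
    (hK : K ∈ Indep b) (hKJ : K ⊆ integrability b lam) {v : V} (hv : IsSingular b lam v) (i : ι) :
    toU (b.e i) • fHole b lam K • v = 0 := by
  by_cases hi : i ∈ K
  · have hKI : insert i (K.erase i) ∈ Indep b := by rwa [Finset.insert_erase hi]
    rw [fHole, ← Finset.insert_erase hi, fProd_insert b (by simp) hKI, mul_smul,
      toU_e_smul_f_pow_succ_smul b i (c := lam (b.h' i)), ← pairingNat_eq b lam (hKJ hi)]
    · simp
    · rw [smul_smul, (commute_e_fProd b (by simp) _).eq, mul_smul, hv.e_smul, smul_zero]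
    · rw [smul_smul, (commute_h_fProd b (by simp) hKI _).eq, mul_smul, hv.h_i_smul,
        smul_smul_comm]
  · rw [smul_smul, fHole, (commute_e_fProd b hi _).eq, mul_smul, hv.e_smul, smul_zero]

end

/-! ### Words in the lowering operators -/

section Words

variable {ι : Type v} [Fintype ι] (b : LieAlgebra.Basis ι 𝔥) (lam : Module.Dual ℂ 𝔥)

/-- The weight `λ - ∑ α_j`, sum over the letters of `w`, of the word `w` in the `f_j` applied to a
vector of weight `λ`. -/
def wordWeight (w : List ι) : Module.Dual ℂ 𝔥 := lam - (w.map b.baseSupp).sum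

theorem wordWeight_cons (i : ι) (w : List ι) :
    wordWeight b lam (i :: w) = wordWeight b lam w - b.baseSupp i := by
  simp [wordWeight, sub_sub, add_comm]

/-- The operator `f_i` on the vector space with basis the words. This space is the Verma module of
the Lie algebra with the Chevalley generators and relations, but without the Serre relations. -/
def wordF (i : ι) : Module.End ℂ (List ι →₀ ℂ) := Finsupp.lmapDomain ℂ ℂ (List.cons i)

omit [Fintype ι] in
@[simp]
theorem wordF_single (i : ι) (w : List ι) (c : ℂ) :
    wordF i (Finsupp.single w c) = Finsupp.single (i :: w) c := by
  simp [wordF, Finsupp.mapDomain_single]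

/-- The operator of `h ∈ 𝔥` on words, of highest weight `λ`. -/
def wordH (h : 𝔥) : Module.End ℂ (List ι →₀ ℂ) :=
  Finsupp.linearCombination ℂ fun w => wordWeight b lam w h • Finsupp.single w 1

@[simp]
theorem wordH_single (h : 𝔥) (w : List ι) :
    wordH b lam h (Finsupp.single w 1) = wordWeight b lam w h • Finsupp.single w 1 := by
  simp [wordH]

open Classical in
/-- The image of a word under `e_i`, from `e_i f_j = f_j e_i + δ_{ij} h_i`. -/
def wordEVec (i : ι) : List ι → (List ι →₀ ℂ)
  | [] => 0
  | j :: w => wordF j (wordEVec i w) +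
      if i = j then wordH b lam (b.h' i) (Finsupp.single w 1) else 0

/-- The operator `e_i` on words, of highest weight `λ`. -/
def wordE (i : ι) : Module.End ℂ (List ι →₀ ℂ) :=
  Finsupp.linearCombination ℂ (wordEVec b lam i)

theorem wordE_single_nil (i : ι) : wordE b lam i (Finsupp.single [] 1) = 0 := by
  simp [wordE, wordEVec]

open Classical in
theorem wordE_single_cons (i j : ι) (w : List ι) :
    wordE b lam i (Finsupp.single (j :: w) 1) = wordF j (wordE b lam i (Finsupp.single w 1)) +
      if i = j then wordH b lam (b.h' i) (Finsupp.single w 1) else 0 := by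
  simp [wordE, wordEVec]

/-- The operators `e_i` do not lengthen words, so the words of bounded length span a space stable
under `𝔫⁺`. -/
theorem wordE_mem_supported (i : ι) (n : ℕ) {m : List ι →₀ ℂ}
    (hm : m ∈ Finsupp.supported ℂ ℂ {w : List ι | w.length ≤ n}) :
    wordE b lam i m ∈ Finsupp.supported ℂ ℂ {w : List ι | w.length ≤ n} := by
  have key : ∀ w : List ι, wordE b lam i (Finsupp.single w 1) ∈
      Finsupp.supported ℂ ℂ {w' : List ι | w'.length ≤ w.length} := by
    intro w
    induction w with
    | nil => rw [wordE_single_nil]; exact zero_mem _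
    | cons j w ih =>
      rw [wordE_single_cons]
      refine add_mem ?_ ?_
      · have hle : (Finsupp.supported ℂ ℂ {w' : List ι | w'.length ≤ w.length}) ≤
            (Finsupp.supported ℂ ℂ {w' : List ι | w'.length ≤ (j :: w).length}).comap
              (wordF j) := by
          rw [Finsupp.supported_eq_span_single, Submodule.span_le]
          rintro - ⟨w', hw', rfl⟩
          rw [SetLike.mem_coe, Submodule.mem_comap, wordF_single]
          exact Finsupp.single_mem_supported ℂ _ (by simpa using hw')
        exact hle ih
      · split_ifs
        · rw [wordH_single]
          exact Submodule.smul_mem _ _ (Finsupp.single_mem_supported ℂ _ (by simp))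
        · exact zero_mem _
  have hle : Finsupp.supported ℂ ℂ {w : List ι | w.length ≤ n} ≤
      (Finsupp.supported ℂ ℂ {w : List ι | w.length ≤ n}).comap (wordE b lam i) := by
    conv_lhs => rw [Finsupp.supported_eq_span_single]
    rw [Submodule.span_le]
    rintro - ⟨w, hw, rfl⟩
    have hsub : {w' : List ι | w'.length ≤ w.length} ⊆ {w | w.length ≤ n} :=
      Set.ofPred_subset_ofPred.mpr fun w' hw' => le_trans hw' hw
    exact Finsupp.supported_mono hsub (key w)
  exact hle hm

section Module

variable {V : Type w} [AddCommGroup V] [Module ℂ V] [Module (Ug 𝔤) V] [IsScalarTower ℂ (Ug 𝔤) V]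

/-- The linear map sending a word in the lowering operators to its value on `y`. -/
def wordMap (y : V) : (List ι →₀ ℂ) →ₗ[ℂ] V :=
  Finsupp.linearCombination ℂ fun w => (w.map fun i => toU (b.f i)).prod • y

omit [IsScalarTower ℂ (Ug 𝔤) V] in
theorem wordMap_single (y : V) (w : List ι) :
    wordMap b y (Finsupp.single w 1) = (w.map fun i => toU (b.f i)).prod • y := by
  simp [wordMap]

theorem wordMap_wordF (y : V) (i : ι) (m : List ι →₀ ℂ) :
    wordMap b y (wordF i m) = toU (b.f i) • wordMap b y m := by
  induction m using Finsupp.induction_linear with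
  | zero => simp
  | add m n hm hn => simp only [map_add, hm, hn, smul_add]
  | single w c =>
    rw [← mul_one c, ← smul_eq_mul, ← Finsupp.smul_single, map_smul, map_smul, map_smul,
      wordF_single, wordMap_single, wordMap_single, smul_smul_comm, List.map_cons,
      List.prod_cons, mul_smul]

variable {b lam}

theorem toU_h_smul_word_smul {y : V} (hy : IsSingular b lam y) (h : 𝔥) (w : List ι) :
    toU (h : 𝔤) • (w.map fun i => toU (b.f i)).prod • y =
      wordWeight b lam w h • (w.map fun i => toU (b.f i)).prod • y := by
  induction w with
  | nil => simpa [wordWeight] using hy.h_smul h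
  | cons i w ih =>
    have hbr : ⁅(h : 𝔤), b.f i⁆ = -(b.baseSupp i h • b.f i) := by
      rw [b.baseSupp_apply_smul_f, neg_neg]; rfl
    rw [List.map_cons, List.prod_cons, mul_smul, toU_smul_toU_smul, ih, hbr, toU_eq (-_), map_neg,
      map_smul, ← toU_eq, neg_smul, smul_assoc, smul_smul_comm, wordWeight_cons]
    generalize toU (b.f i) • (w.map fun i => toU (b.f i)).prod • y = z
    rw [LinearMap.sub_apply]
    module

theorem wordMap_wordE {y : V} (hy : IsSingular b lam y) (i : ι) (m : List ι →₀ ℂ) :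
    wordMap b y (wordE b lam i m) = toU (b.e i) • wordMap b y m := by
  induction m using Finsupp.induction_linear with
  | zero => simp
  | add m n hm hn => simp only [map_add, hm, hn, smul_add]
  | single w c =>
    rw [← mul_one c, ← smul_eq_mul, ← Finsupp.smul_single, map_smul, map_smul, map_smul,
      smul_smul_comm]
    congr 1
    induction w with
    | nil => rw [wordE_single_nil, map_zero, wordMap_single, List.map_nil, List.prod_nil, one_smul,
        hy.e_smul]
    | cons j w ih =>
      rw [wordE_single_cons, map_add, wordMap_wordF, ih, wordMap_single, wordMap_single,
        List.map_cons, List.prod_cons, mul_smul, toU_smul_toU_smul (b.e i)]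
      congr 1
      split_ifs with hij
      · subst hij
        rw [(b.sl2 i).lie_e_f, wordH_single, map_smul, wordMap_single]
        exact (toU_h_smul_word_smul hy (b.h' i) w).symm
      · rw [b.lie_e_f_ne i j hij, toU_eq, map_zero, map_zero, zero_smul]

theorem smul_mem_range_wordMap {y : V} (hy : IsSingular b lam y) (a : Ug 𝔤) :
    a • y ∈ LinearMap.range (wordMap b y) := by
  refine smul_mem_of_generators b.span_ef _ ?_ a ⟨Finsupp.single [] 1, by simp [wordMap_single]⟩
  rintro - (⟨i, rfl⟩ | ⟨i, rfl⟩) - ⟨m, rfl⟩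
  · exact ⟨_, wordMap_wordE hy i m⟩
  · exact ⟨_, wordMap_wordF b y i m⟩

/-- A subspace containing all words in the lowering operators applied to a singular vector contains
the submodule generated by this vector. -/
theorem smul_mem_of_word_smul_mem {y : V} (hy : IsSingular b lam y) (N : Submodule ℂ V)
    (hN : ∀ w : List ι, (w.map fun i => toU (b.f i)).prod • y ∈ N) (a : Ug 𝔤) : a • y ∈ N := by
  obtain ⟨m, hm⟩ := smul_mem_range_wordMap hy a
  rw [← hm]
  exact (Submodule.span_le.mpr (by rintro - ⟨w, rfl⟩; exact hN w) :
    Submodule.span ℂ (Set.range fun w : List ι => (w.map fun i => toU (b.f i)).prod • y) ≤ N)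
    (by rw [← Finsupp.range_linearCombination]; exact ⟨m, rfl⟩)

end Module

end Words

/-! ### Highest weight modules -/

section HighestWeight

variable {ι : Type v} [Fintype ι] (b : LieAlgebra.Basis ι 𝔥)

theorem exists_baseSupp_eq_one : ∃ r : 𝔥, ∀ i, b.baseSupp i r = 1 := by
  classical
  have hdet : IsUnit (b.A.map (Int.cast : ℤ → ℂ)) := by
    rw [Matrix.isUnit_iff_isUnit_det, isUnit_iff_ne_zero]
    have h := (Int.castRingHom ℂ).map_det b.A
    have h0 := b.nondegen.det_ne_zero
    intro h1
    apply h0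
    have : ((b.A.det : ℤ) : ℂ) = 0 := by
      rw [← h1]; exact h
    exact_mod_cast this
  obtain ⟨x, hx⟩ := Matrix.mulVec_surjective_iff_isUnit.mpr hdet fun _ => 1
  refine ⟨∑ j, x j • b.h' j, fun i => ?_⟩
  have := congrFun hx i
  simp only [Matrix.mulVec, dotProduct, Matrix.map_apply] at this
  rw [← this, map_sum]
  exact Finset.sum_congr rfl fun j _ => by simp [mul_comm]

/-- An element `ρ^∨` of `𝔥` on which all simple roots take the value `1`. It grades highest weight
modules by the number of lowering operators. -/
def rhoCheck : 𝔥 := (exists_baseSupp_eq_one b).choose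

@[simp]
theorem baseSupp_rhoCheck (i : ι) : b.baseSupp i (rhoCheck b) = 1 :=
  (exists_baseSupp_eq_one b).choose_spec i

theorem wordWeight_rhoCheck (lam : Module.Dual ℂ 𝔥) (w : List ι) :
    wordWeight b lam w (rhoCheck b) = lam (rhoCheck b) - w.length := by
  induction w with
  | nil => simp [wordWeight]
  | cons i w ih =>
    rw [wordWeight_cons, LinearMap.sub_apply, ih, baseSupp_rhoCheck, List.length_cons]
    push_cast
    ring

variable (lam : Module.Dual ℂ 𝔥)
  (V : Type w) [AddCommGroup V] [Module ℂ V] [Module (Ug 𝔤) V] [IsScalarTower ℂ (Ug 𝔤) V]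

/-- The action of `ρ^∨` on a module, as a complex linear map. -/
def rhoAct : Module.End ℂ V where
  toFun y := toU (rhoCheck b : 𝔤) • y
  map_add' := smul_add _
  map_smul' c y := smul_smul_comm c _ y

/-- The sum of the eigenspaces of `ρ^∨` for the eigenvalues other than `λ(ρ^∨)`. In a module of
highest weight `λ` this is the sum of the weight spaces other than that of `λ`. -/
def lowerPart : Submodule ℂ V :=
  ⨆ c ≠ lam (rhoCheck b), (rhoAct b V).eigenspace c

variable {b lam V}

theorem word_smul_mem_lowerPart {mu : Module.Dual ℂ 𝔥} {y : V} (hy : IsSingular b mu y)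
    (w : List ι) (hw : mu (rhoCheck b) - w.length ≠ lam (rhoCheck b)) :
    (w.map fun i => toU (b.f i)).prod • y ∈ lowerPart b lam V := by
  refine Submodule.mem_iSup_of_mem _ (Submodule.mem_iSup_of_mem hw ?_)
  rw [Module.End.mem_eigenspace_iff, ← wordWeight_rhoCheck]
  exact toU_h_smul_word_smul hy (rhoCheck b) w

theorem IsSingular.eq_zero_of_mem_lowerPart {v : V} (hv : IsSingular b lam v)
    (h : v ∈ lowerPart b lam V) : v = 0 := by
  have hd := (Module.End.eigenspaces_iSupIndep (rhoAct b V)) (lam (rhoCheck b))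
  refine (Submodule.disjoint_def.mp hd) v ?_ h
  rw [Module.End.mem_eigenspace_iff]
  exact hv.h_smul (rhoCheck b)

theorem IsSingular.smul {v : V} (hv : IsSingular b lam v) (c : ℂ) :
    IsSingular b lam (c • v) where
  e_smul i := by rw [smul_smul_comm, hv.e_smul, smul_zero]
  h_smul h := by rw [smul_smul_comm, hv.h_smul, smul_comm]

variable (b lam) in
/-- `v` is a vector of highest weight `λ` which generates `V`. It is zero when `V` is. -/
structure IsHighestWeightVector (v : V) : Prop extends IsSingular b lam v where
  generates : ∀ x : V, ∃ a : Ug 𝔤, a • v = x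

theorem IsHighestWeightVector.map {W : Type*} [AddCommGroup W] [Module ℂ W] [Module (Ug 𝔤) W]
    [IsScalarTower ℂ (Ug 𝔤) W] {v : V} (hv : IsHighestWeightVector b lam v)
    (φ : V →ₗ[Ug 𝔤] W) (hφ : Function.Surjective φ) : IsHighestWeightVector b lam (φ v) where
  toIsSingular := hv.toIsSingular.map φ
  generates x := by
    obtain ⟨y, rfl⟩ := hφ x
    obtain ⟨a, rfl⟩ := hv.generates y
    exact ⟨a, (map_smul φ a v).symm⟩

omit [IsScalarTower ℂ (Ug 𝔤) V] in
theorem IsHighestWeightVector.hom_ext {W : Type*} [AddCommGroup W] [Module (Ug 𝔤) W]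
    {v : V} (hv : IsHighestWeightVector b lam v) {φ ψ : V →ₗ[Ug 𝔤] W} (h : φ v = ψ v) : φ = ψ := by
  ext x
  obtain ⟨a, rfl⟩ := hv.generates x
  rw [map_smul, map_smul, h]

theorem IsHighestWeightVector.exists_sub_smul_mem_lowerPart {v : V}
    (hv : IsHighestWeightVector b lam v) (x : V) : ∃ c : ℂ, x - c • v ∈ lowerPart b lam V := by
  obtain ⟨a, rfl⟩ := hv.generates x
  have : a • v ∈ Submodule.span ℂ {v} ⊔ lowerPart b lam V := by
    refine smul_mem_of_word_smul_mem hv.toIsSingular _ (fun w => ?_) a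
    rcases w with - | ⟨i, w⟩
    · exact Submodule.mem_sup_left (by simp [Submodule.mem_span_singleton_self])
    · refine Submodule.mem_sup_right (word_smul_mem_lowerPart hv.toIsSingular _ ?_)
      rw [List.length_cons, Ne, sub_eq_self]
      exact Nat.cast_ne_zero.mpr (Nat.succ_ne_zero _)
  obtain ⟨y, hy, z, hz, hyz⟩ := Submodule.mem_sup.mp this
  obtain ⟨c, rfl⟩ := Submodule.mem_span_singleton.mp hy
  exact ⟨c, by rw [← hyz, add_sub_cancel_left]; exact hz⟩

/-- The highest weight space of a highest weight module is a line. -/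
theorem IsHighestWeightVector.exists_eq_smul {v : V} (hv : IsHighestWeightVector b lam v) {x : V}
    (hx : x ∈ weightSpace V lam) : ∃ c : ℂ, x = c • v := by
  obtain ⟨c, hc⟩ := hv.exists_sub_smul_mem_lowerPart x
  refine ⟨c, sub_eq_zero.mp ?_⟩
  have hd := (Module.End.eigenspaces_iSupIndep (rhoAct b V)) (lam (rhoCheck b))
  refine (Submodule.disjoint_def.mp hd) _ ?_ hc
  refine Submodule.sub_mem _ ?_ (Submodule.smul_mem _ _ ?_) <;>
    rw [Module.End.mem_eigenspace_iff]
  · exact hx (rhoCheck b)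
  · exact hv.h_smul (rhoCheck b)

omit [Fintype ι] in
theorem IsSingular.mem_weightSpace [Finite ι] {b : LieAlgebra.Basis ι 𝔥} {v : V}
    (hv : IsSingular b lam v) : v ∈ weightSpace V lam := hv.h_smul

/-- Proper submodules of a highest weight module lie in its lower part: the image of the generator
in the quotient is a nonzero highest weight vector. -/
theorem IsHighestWeightVector.mem_lowerPart_of_mem {v : V} (hv : IsHighestWeightVector b lam v)
    {N : Submodule (Ug 𝔤) V} (hN : N ≠ ⊤) {x : V} (hx : x ∈ N) : x ∈ lowerPart b lam V := by
  obtain ⟨c, hc⟩ := hv.exists_sub_smul_mem_lowerPart x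
  have hq : ∀ y : V, y ∈ lowerPart b lam V → N.mkQ y ∈ lowerPart b lam (V ⧸ N) := by
    let π : V →ₗ[ℂ] V ⧸ N := N.mkQ.restrictScalars ℂ
    suffices lowerPart b lam V ≤ (lowerPart b lam (V ⧸ N)).comap π from fun y hy => this hy
    refine iSup₂_le fun d hd y hy => ?_
    refine Submodule.mem_iSup_of_mem d (Submodule.mem_iSup_of_mem hd ?_)
    rw [Module.End.mem_eigenspace_iff] at hy ⊢
    have := congrArg π hy
    rw [map_smul] at this
    exact this
  have h1 := hq _ hc
  have hx0 : N.mkQ x = 0 := (Submodule.Quotient.mk_eq_zero N).mpr hx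
  rw [map_sub, hx0, zero_sub, neg_mem_iff] at h1
  have h2 := ((hv.toIsSingular.smul c).map N.mkQ).eq_zero_of_mem_lowerPart h1
  have h3 : c • v ∈ N := (Submodule.Quotient.mk_eq_zero N).mp h2
  by_cases hc0 : c = 0
  · rwa [hc0, zero_smul, sub_zero] at hc
  · exfalso
    apply hN
    rw [eq_top_iff]
    intro z _
    obtain ⟨a, rfl⟩ := hv.generates z
    have hvN : v ∈ N := by
      have := N.smul_mem (algebraMap ℂ (Ug 𝔤) c⁻¹) h3
      rwa [algebraMap_smul, smul_smul, inv_mul_cancel₀ hc0, one_smul] at this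
    exact N.smul_mem a hvN

/-- Highest weight modules belong to category `𝒪`. -/
theorem IsHighestWeightVector.memO {v : V} (hv : IsHighestWeightVector b lam v) : MemO b V where
  finite := by
    refine ⟨⟨{v}, ?_⟩⟩
    rw [eq_top_iff]
    intro x _
    obtain ⟨a, rfl⟩ := hv.generates x
    exact Submodule.smul_mem _ a (Submodule.subset_span (by simp))
  weight := by
    rw [eq_top_iff]
    intro x _
    obtain ⟨a, rfl⟩ := hv.generates x
    refine smul_mem_of_word_smul_mem hv.toIsSingular _ (fun w => ?_) a
    exact Submodule.mem_iSup_of_mem (wordWeight b lam w) fun h =>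
      toU_h_smul_word_smul hv.toIsSingular h w
  locallyFinite x := by
    obtain ⟨a, rfl⟩ := hv.generates x
    obtain ⟨m, hm⟩ := smul_mem_range_wordMap hv.toIsSingular a
    rw [← hm]
    -- The words of length at most `n` span a finite-dimensional space stable under all `e_i`.
    set n := m.support.sup List.length
    let S := Finsupp.supported ℂ ℂ {w : List ι | w.length ≤ n}
    have hmS : m ∈ S := (Finsupp.mem_supported ℂ m).mpr fun w hw =>
      Finset.le_sup (f := List.length) hw
    have hfin : Finite {w : List ι | w.length ≤ n} := (List.finite_length_le ι n).to_subtype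
    have hS : FiniteDimensional ℂ S :=
      Module.Finite.equiv (Finsupp.supportedEquivFinsupp (M := ℂ) (R := ℂ) _).symm
    have hstable : ∀ u ∈ Uplus b, ∀ z ∈ S.map (wordMap b v), u • z ∈ S.map (wordMap b v) := by
      intro u hu
      induction hu using Algebra.adjoin_induction with
      | mem x hx =>
        obtain ⟨i, rfl⟩ := hx
        rintro - ⟨s, hs, rfl⟩
        exact ⟨wordE b lam i s, wordE_mem_supported b lam i n hs,
          wordMap_wordE hv.toIsSingular i s⟩
      | algebraMap r => intro z hz; rw [algebraMap_smul]; exact Submodule.smul_mem _ r hz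
      | add p q _ _ hp hq =>
        intro z hz; rw [add_smul]; exact Submodule.add_mem _ (hp z hz) (hq z hz)
      | mul p q _ _ hp hq => intro z hz; rw [mul_smul]; exact hp _ (hq z hz)
    refine Submodule.finiteDimensional_of_le (S₂ := S.map (wordMap b v)) ?_
    rw [Submodule.span_le]
    rintro - ⟨u, hu, rfl⟩
    exact hstable u hu _ ⟨m, hmS, rfl⟩

end HighestWeight

/-! ### Nonvanishing of Verma modules -/

section NonvanishingOfVerma

-- The commutator bracket on the endomorphisms of the space of words.
attribute [local instance] LieRing.ofAssociativeRing

section Relations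

variable {ι : Type v} [Fintype ι] (b : LieAlgebra.Basis ι 𝔥) (lam : Module.Dual ℂ 𝔥)

omit [Fintype ι] in
theorem end_word_ext {M : Type*} [AddCommGroup M] [Module ℂ M] {S T : (List ι →₀ ℂ) →ₗ[ℂ] M}
    (h : ∀ w, S (Finsupp.single w 1) = T (Finsupp.single w 1)) : S = T :=
  Finsupp.lhom_ext' fun w => LinearMap.ext_ring (h w)

omit [Fintype ι] in
theorem lie_end_word_apply (S T : Module.End ℂ (List ι →₀ ℂ)) (m : List ι →₀ ℂ) :
    ⁅S, T⁆ m = S (T m) - T (S m) := rfl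

theorem lie_wordH_wordH (h h' : 𝔥) : ⁅wordH b lam h, wordH b lam h'⁆ = 0 := by
  refine end_word_ext fun w => ?_
  rw [lie_end_word_apply, wordH_single, wordH_single, map_smul, map_smul, wordH_single,
    wordH_single, smul_comm, sub_self, LinearMap.zero_apply]

theorem lie_wordH_wordF (h : 𝔥) (i : ι) :
    ⁅wordH b lam h, wordF i⁆ = -(b.baseSupp i h • wordF i) := by
  refine end_word_ext fun w => ?_
  simp only [lie_end_word_apply, wordF_single, wordH_single, map_smul, wordWeight_cons,
    LinearMap.neg_apply, LinearMap.smul_apply, LinearMap.sub_apply]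
  module

theorem lie_wordE_wordF [DecidableEq ι] (i j : ι) :
    ⁅wordE b lam i, wordF j⁆ = if i = j then wordH b lam (b.h' i) else 0 := by
  refine end_word_ext fun w => ?_
  simp only [lie_end_word_apply, wordF_single, wordE_single_cons]
  split_ifs <;> simp

theorem lie_wordH_wordE (h : 𝔥) (i : ι) :
    ⁅wordH b lam h, wordE b lam i⁆ = b.baseSupp i h • wordE b lam i := by
  classical
  refine end_word_ext fun w => ?_
  rw [lie_end_word_apply, LinearMap.smul_apply]
  induction w with
  | nil => rw [wordE_single_nil, wordH_single, map_smul, wordE_single_nil]; simp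
  | cons j w ih =>
    have h1 : ∀ m, wordH b lam h (wordF j m) =
        wordF j (wordH b lam h m) - b.baseSupp j h • wordF j m := by
      intro m
      have := congrArg (fun T : Module.End ℂ (List ι →₀ ℂ) => T m) (lie_wordH_wordF b lam h j)
      simp only [lie_end_word_apply, LinearMap.neg_apply, LinearMap.smul_apply] at this
      rw [sub_eq_iff_eq_add] at this
      rw [this]; abel
    rw [sub_eq_iff_eq_add, wordH_single, map_smul] at ih
    rw [wordH_single b lam h (j :: w), map_smul, wordE_single_cons, map_add, h1, ih,
      wordWeight_cons, LinearMap.sub_apply]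
    split_ifs with hij
    · subst hij
      simp only [map_add, map_smul, wordH_single]
      module
    · simp only [map_add, map_smul, map_zero, add_zero]
      module

end Relations

section Cover

variable {ι : Type v} [Fintype ι] (b : LieAlgebra.Basis ι 𝔥) (lam : Module.Dual ℂ 𝔥)

/-- The Lie algebra generated by the pairs of a Chevalley generator of `𝔤` and its operator on
words. It maps onto `𝔤`, it acts on words, and it satisfies the Chevalley relations. -/
def wordCover : LieSubalgebra ℂ (Module.End ℂ (List ι →₀ ℂ) × 𝔤) :=
  LieSubalgebra.lieSpan ℂ _
    (Set.range (fun i => (wordE b lam i, b.e i)) ∪ Set.range (fun i => (wordF i, b.f i)))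

/-- The lift of `e_i`. -/
def coverE (i : ι) : wordCover b lam :=
  ⟨(wordE b lam i, b.e i), LieSubalgebra.subset_lieSpan (Or.inl ⟨i, rfl⟩)⟩

/-- The lift of `f_i`. -/
def coverF (i : ι) : wordCover b lam :=
  ⟨(wordF i, b.f i), LieSubalgebra.subset_lieSpan (Or.inr ⟨i, rfl⟩)⟩

/-- The lift of `h_i`. -/
def coverH (i : ι) : wordCover b lam := ⁅coverE b lam i, coverF b lam i⁆

theorem coe_coverH (i : ι) :
    (coverH b lam i : Module.End ℂ (List ι →₀ ℂ) × 𝔤) = (wordH b lam (b.h' i), b.h i) := by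
  classical
  change (⁅wordE b lam i, wordF i⁆, ⁅b.e i, b.f i⁆) = _
  rw [lie_wordE_wordF, if_pos rfl, (b.sl2 i).lie_e_f]

/-- The action of the cover on words. -/
def coverAct : wordCover b lam →ₗ⁅ℂ⁆ Module.End ℂ (List ι →₀ ℂ) :=
  (LieHom.fst ℂ _ _).comp (wordCover b lam).incl

/-- The projection of the cover onto `𝔤`. -/
def coverProj : wordCover b lam →ₗ⁅ℂ⁆ 𝔤 := (LieHom.snd ℂ _ _).comp (wordCover b lam).incl

@[simp]
theorem coverAct_coverE (i : ι) : coverAct b lam (coverE b lam i) = wordE b lam i := rfl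

@[simp]
theorem coverAct_coverF (i : ι) : coverAct b lam (coverF b lam i) = wordF i := rfl

@[simp]
theorem coverAct_coverH (i : ι) : coverAct b lam (coverH b lam i) = wordH b lam (b.h' i) :=
  congrArg Prod.fst (coe_coverH b lam i)

@[simp]
theorem coverProj_coverE (i : ι) : coverProj b lam (coverE b lam i) = b.e i := rfl

@[simp]
theorem coverProj_coverF (i : ι) : coverProj b lam (coverF b lam i) = b.f i := rfl

@[simp]
theorem coverProj_coverH (i : ι) : coverProj b lam (coverH b lam i) = b.h i :=
  congrArg Prod.snd (coe_coverH b lam i)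

variable {b lam} in
theorem wordCover_ext {x y : wordCover b lam} (h1 : coverAct b lam x = coverAct b lam y)
    (h2 : coverProj b lam x = coverProj b lam y) : x = y :=
  Subtype.ext (Prod.ext h1 h2)

theorem lieSpan_coverE_coverF :
    LieSubalgebra.lieSpan ℂ (wordCover b lam)
      (Set.range (coverE b lam) ∪ Set.range (coverF b lam)) = ⊤ := by
  have hr : Set.range (coverE b lam) ∪ Set.range (coverF b lam) = Subtype.val ⁻¹'
      (Set.range (fun i => (wordE b lam i, b.e i)) ∪ Set.range (fun i => (wordF i, b.f i))) := by
    ext x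
    simp only [Set.mem_union, Set.mem_range, Set.mem_preimage, Subtype.ext_iff, coverE, coverF]
  rw [hr]
  exact LieSubalgebra.lieSpan_lieSpan_coe_preimage

theorem coverProj_surjective : Function.Surjective (coverProj b lam) := by
  rw [← LieHom.range_eq_top, eq_top_iff, ← b.span_ef, LieSubalgebra.lieSpan_le]
  rintro - (⟨i, rfl⟩ | ⟨i, rfl⟩)
  · exact ⟨coverE b lam i, rfl⟩
  · exact ⟨coverF b lam i, rfl⟩

/-- The lifted Chevalley generators satisfy the Chevalley relations, so that the cover has a
triangular decomposition. -/
def coverBasis :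
    LieAlgebra.Basis ι (LieSubalgebra.lieSpan ℂ (wordCover b lam) (Set.range (coverH b lam))) where
  A := b.A
  h := coverH b lam
  e := coverE b lam
  f := coverF b lam
  cartan_eq_lieSpan := rfl
  span_ef := lieSpan_coverE_coverF b lam
  linInd := by
    refine LinearIndependent.of_comp (coverProj b lam : wordCover b lam →ₗ[ℂ] 𝔤) ?_
    convert b.linInd using 1
    funext i
    exact coverProj_coverH b lam i
  nondegen := b.nondegen
  sl2 i :=
    haveI : IsAddTorsionFree 𝔤 := .of_isTorsionFree ℂ 𝔤
    { h_ne_zero := fun h => (b.sl2 i).h_ne_zero (by rw [← coverProj_coverH b lam, h, map_zero])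
      lie_e_f := rfl
      lie_h_e_nsmul := by
        refine wordCover_ext ?_ ?_
        · rw [LieHom.map_lie, map_nsmul, coverAct_coverH, coverAct_coverE, lie_wordH_wordE]
          rw [b.baseSupp_apply_h', b.A_diag_eq_two, Int.cast_ofNat, ofNat_smul_eq_nsmul]
        · simp [LieHom.map_lie, (b.sl2 i).lie_h_e_nsmul]
      lie_h_f_nsmul := by
        refine wordCover_ext ?_ ?_
        · rw [LieHom.map_lie, map_neg, map_nsmul, coverAct_coverH, coverAct_coverF,
            lie_wordH_wordF]
          rw [b.baseSupp_apply_h', b.A_diag_eq_two, Int.cast_ofNat, ofNat_smul_eq_nsmul]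
        · simp [LieHom.map_lie, (b.sl2 i).lie_h_f_nsmul] }
  lie_h_h i j := by
    refine wordCover_ext ?_ ?_
    · rw [LieHom.map_lie, coverAct_coverH, coverAct_coverH, lie_wordH_wordH, map_zero]
    · simp [LieHom.map_lie, b.lie_h_h]
  lie_h_e i j := by
    refine wordCover_ext ?_ ?_
    · rw [LieHom.map_lie, map_zsmul, coverAct_coverH, coverAct_coverE, lie_wordH_wordE,
        b.baseSupp_apply_h']
      exact Int.cast_smul_eq_zsmul ℂ (b.A i j) (wordE b lam i)
    · rw [LieHom.map_lie, map_zsmul, coverProj_coverH, coverProj_coverE, b.lie_h_e]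
  lie_h_f i j := by
    refine wordCover_ext ?_ ?_
    · rw [LieHom.map_lie, map_zsmul, coverAct_coverH, coverAct_coverF, lie_wordH_wordF,
        b.baseSupp_apply_h']
      rw [neg_smul]
      exact congrArg Neg.neg (Int.cast_smul_eq_zsmul ℂ (b.A i j) (wordF (ι := ι) i))
    · rw [LieHom.map_lie, map_zsmul, coverProj_coverH, coverProj_coverF, b.lie_h_f]
  lie_e_f_ne i j hij := by
    classical
    refine wordCover_ext ?_ ?_
    · rw [LieHom.map_lie, coverAct_coverE, coverAct_coverF, lie_wordE_wordF, if_neg hij, map_zero]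
    · rw [LieHom.map_lie, coverProj_coverE, coverProj_coverF, b.lie_e_f_ne i j hij, map_zero]

/-- The components of `0` in the triangular decomposition of `𝔤` vanish. -/
theorem triangular_eq_zero {x y z : 𝔤} (hx : x ∈ 𝔥)
    (hy : y ∈ LieSubalgebra.lieSpan ℂ 𝔤 (Set.range b.f))
    (hz : z ∈ LieSubalgebra.lieSpan ℂ 𝔤 (Set.range b.e)) (h : x + y + z = 0) : x = 0 := by
  have hind := b.iSupIndep_rootSpace
  rw [← b.cartan_eq, ← b.borelLower_eq, ← b.borelUpper_eq, iSupIndep_fin_three] at hind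
  have hd : Disjoint 𝔥.toLieSubmodule (b.borelLower ⊔ b.borelUpper) := by
    simpa using hind.1
  have hyz : x = -y + -z := by
    rw [add_assoc] at h
    rw [eq_neg_of_add_eq_zero_left h]; abel
  have hmem : x ∈ b.borelLower ⊔ b.borelUpper := by
    rw [hyz]
    exact add_mem (LieSubmodule.mem_sup_left (neg_mem (S := LieSubmodule ℂ 𝔥 𝔤) hy))
      (LieSubmodule.mem_sup_right (neg_mem (S := LieSubmodule ℂ 𝔥 𝔤) hz))
  have := hd.le_bot (⟨hx, hmem⟩ : x ∈ 𝔥.toLieSubmodule ⊓ (b.borelLower ⊔ b.borelUpper))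
  simpa using this

/-- The span of the nonempty words. -/
def nonemptyWords (ι : Type v) : Submodule ℂ (List ι →₀ ℂ) :=
  Finsupp.supported ℂ ℂ {w : List ι | w ≠ []}

omit [Fintype ι] in
theorem wordF_mem_nonemptyWords (i : ι) (m : List ι →₀ ℂ) : wordF i m ∈ nonemptyWords ι := by
  induction m using Finsupp.induction_linear with
  | zero => simp
  | add m n hm hn => rw [map_add]; exact add_mem hm hn
  | single w c =>
    rw [wordF_single]
    exact Finsupp.single_mem_supported ℂ _ (by simp)

/-- An element of the kernel of the projection to `𝔤` has no component in the Cartan subalgebra,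
and so sends the empty word to a combination of nonempty words. -/
theorem coverAct_single_nil_mem {x : wordCover b lam} (hx : coverProj b lam x = 0) :
    coverAct b lam x (Finsupp.single [] 1) ∈ nonemptyWords ι := by
  set B := coverBasis b lam
  obtain ⟨x0, hx0, xm, hxm, xp, hxp, rfl⟩ : ∃ᵉ
      (x0 ∈ LieSubalgebra.lieSpan ℂ (wordCover b lam) (Set.range (coverH b lam)))
      (xm ∈ LieSubalgebra.lieSpan ℂ (wordCover b lam) (Set.range (coverF b lam)))
      (xp ∈ LieSubalgebra.lieSpan ℂ (wordCover b lam) (Set.range (coverE b lam))),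
      x0 + xm + xp = x := by
    have h1 : x ∈ iSup ![(LieSubalgebra.lieSpan ℂ (wordCover b lam)
        (Set.range (coverH b lam))).toLieSubmodule, B.borelLower, B.borelUpper] := by
      rw [B.iSup_cartan_borelLower_borelUpper_eq_top]; trivial
    have h2 : x ∈ (LieSubalgebra.lieSpan ℂ (wordCover b lam)
        (Set.range (coverH b lam))).toLieSubmodule ⊔ B.borelLower ⊔ B.borelUpper := by
      simpa using h1
    obtain ⟨y, hy, z, hz, rfl⟩ := (LieSubmodule.mem_sup _ _ _).mp h2
    obtain ⟨y1, hy1, y2, hy2, rfl⟩ := (LieSubmodule.mem_sup _ _ _).mp hy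
    exact ⟨y1, hy1, y2, hy2, z, hz, rfl⟩
  have key : ∀ (c : ι → wordCover b lam) (d : ι → 𝔤), (∀ i, coverProj b lam (c i) = d i) →
      ∀ y ∈ LieSubalgebra.lieSpan ℂ (wordCover b lam) (Set.range c),
        coverProj b lam y ∈ LieSubalgebra.lieSpan ℂ 𝔤 (Set.range d) := by
    intro c d hcd y hy
    have := (LieSubalgebra.mem_map (coverProj b lam) _ _).mpr ⟨y, hy, rfl⟩
    rw [LieSubalgebra.map_lieSpan, ← Set.range_comp] at this
    convert this using 3
    funext i
    exact (hcd i).symm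
  have hx0' : coverProj b lam x0 ∈ 𝔥 := by
    have := key _ _ (coverProj_coverH b lam) x0 hx0
    rwa [← b.cartan_eq_lieSpan] at this
  have hproj : coverProj b lam x0 = 0 :=
    triangular_eq_zero b hx0' (key _ _ (coverProj_coverF b lam) xm hxm)
      (key _ _ (coverProj_coverE b lam) xp hxp) (by rw [← map_add, ← map_add, hx])
  have hx0z : x0 = 0 := by
    have h1 : x0 ∈ Submodule.span ℂ (Set.range (coverH b lam)) := by
      have := B.coe_cartan_eq_span
      rw [← LieSubalgebra.mem_toSubmodule, this] at hx0
      exact hx0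
    obtain ⟨c, rfl⟩ := (Submodule.mem_span_range_iff_exists_fun ℂ).mp h1
    have h2 : ∑ i, c i • b.h i = 0 := by
      rw [← hproj, map_sum]
      exact Finset.sum_congr rfl fun i _ => by rw [map_smul, coverProj_coverH]
    have h3 := Fintype.linearIndependent_iff.mp b.linInd c h2
    simp [h3]
  have hxp0 : coverAct b lam xp (Finsupp.single [] 1) = 0 := by
    clear hproj hx
    induction hxp using LieSubalgebra.lieSpan_induction with
    | mem y hy => obtain ⟨i, rfl⟩ := hy; exact wordE_single_nil b lam i
    | zero => simp
    | add y z _ _ hy hz => rw [map_add, LinearMap.add_apply, hy, hz, add_zero]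
    | smul t y _ hy => rw [map_smul, LinearMap.smul_apply, hy, smul_zero]
    | lie y z _ _ hy hz =>
      rw [LieHom.map_lie, lie_end_word_apply, hy, hz, map_zero, map_zero, sub_zero]
  have hxm0 : ∀ m, coverAct b lam xm m ∈ nonemptyWords ι := by
    clear hproj hx
    induction hxm using LieSubalgebra.lieSpan_induction with
    | mem y hy => obtain ⟨i, rfl⟩ := hy; exact wordF_mem_nonemptyWords i
    | zero => simp
    | add y z _ _ hy hz =>
      intro m; rw [map_add, LinearMap.add_apply]; exact add_mem (hy m) (hz m)
    | smul t y _ hy =>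
      intro m; rw [map_smul, LinearMap.smul_apply]; exact Submodule.smul_mem _ t (hy m)
    | lie y z _ _ hy hz =>
      intro m; rw [LieHom.map_lie, lie_end_word_apply]; exact sub_mem (hy _) (hz _)
  rw [hx0z, zero_add, map_add, LinearMap.add_apply, hxp0, add_zero]
  exact hxm0 _

end Cover

section SerreSubmodule

variable {ι : Type v} [Fintype ι] (b : LieAlgebra.Basis ι 𝔥) (lam : Module.Dual ℂ 𝔥)

/-- The subspace spanned by the words in the `f_i` applied to `x ∅`, for `x` in the kernel of the
projection of the cover to `𝔤`. It is the submodule by which the space of words has to be divided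
for `𝔤` to act. -/
def serreSubmodule : Submodule ℂ (List ι →₀ ℂ) :=
  Submodule.span ℂ {m | ∃ (w : List ι) (x : wordCover b lam), coverProj b lam x = 0 ∧
    m = (w.map wordF).prod (coverAct b lam x (Finsupp.single [] 1))}

variable {b lam}

theorem wordF_mem_serreSubmodule (i : ι) {m : List ι →₀ ℂ} (hm : m ∈ serreSubmodule b lam) :
    wordF i m ∈ serreSubmodule b lam := by
  suffices serreSubmodule b lam ≤ (serreSubmodule b lam).comap (wordF i) from this hm
  refine Submodule.span_le.mpr ?_
  rintro - ⟨w, x, hx, rfl⟩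
  exact Submodule.subset_span ⟨i :: w, x, hx, by simp⟩

theorem serreSubmodule_le : serreSubmodule b lam ≤ nonemptyWords ι := by
  refine Submodule.span_le.mpr ?_
  rintro - ⟨w, x, hx, rfl⟩
  rcases w with - | ⟨i, w⟩
  · exact coverAct_single_nil_mem b lam hx
  · rw [List.map_cons, List.prod_cons]
    exact wordF_mem_nonemptyWords i _

theorem single_nil_notMem_serreSubmodule : Finsupp.single [] 1 ∉ serreSubmodule b lam := by
  intro h
  have := (Finsupp.mem_supported ℂ _).mp (serreSubmodule_le h)
  simp at this

variable (b lam) in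
theorem coverAct_single_nil_mem_serreSubmodule {x : wordCover b lam} (hx : coverProj b lam x = 0) :
    coverAct b lam x (Finsupp.single [] 1) ∈ serreSubmodule b lam :=
  Submodule.subset_span ⟨[], x, hx, by simp⟩

theorem wordH_mem_serreSubmodule (i : ι) {m : List ι →₀ ℂ} (hm : m ∈ serreSubmodule b lam) :
    wordH b lam (b.h' i) m ∈ serreSubmodule b lam := by
  suffices serreSubmodule b lam ≤ (serreSubmodule b lam).comap (wordH b lam (b.h' i)) from this hm
  refine Submodule.span_le.mpr ?_
  rintro - ⟨w, x, hx, rfl⟩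
  rw [SetLike.mem_coe, Submodule.mem_comap]
  induction w with
  | nil =>
    rw [List.map_nil, List.prod_nil, Module.End.one_apply, ← coverAct_coverH]
    have hbr : coverProj b lam ⁅coverH b lam i, x⁆ = 0 := by rw [LieHom.map_lie, hx, lie_zero]
    have h1 := coverAct_single_nil_mem_serreSubmodule b lam hbr
    rw [LieHom.map_lie, lie_end_word_apply, coverAct_coverH, wordH_single, map_smul] at h1
    rw [coverAct_coverH]
    exact (Submodule.sub_mem_iff_left _ (Submodule.smul_mem _ _
      (coverAct_single_nil_mem_serreSubmodule b lam hx))).mp h1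
  | cons j w ih =>
    rw [List.map_cons, List.prod_cons, Module.End.mul_apply]
    set z := (w.map wordF).prod (coverAct b lam x (Finsupp.single [] 1)) with hz
    have hzm : z ∈ serreSubmodule b lam := Submodule.subset_span ⟨w, x, hx, hz⟩
    have h1 := congrArg (fun T : Module.End ℂ (List ι →₀ ℂ) => T z)
      (lie_wordH_wordF b lam (b.h' i) j)
    simp only [lie_end_word_apply, LinearMap.neg_apply, LinearMap.smul_apply] at h1
    rw [sub_eq_iff_eq_add.mp h1]
    exact add_mem (neg_mem (Submodule.smul_mem _ _ (wordF_mem_serreSubmodule j hzm)))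
      (wordF_mem_serreSubmodule j ih)

theorem wordE_mem_serreSubmodule (i : ι) {m : List ι →₀ ℂ} (hm : m ∈ serreSubmodule b lam) :
    wordE b lam i m ∈ serreSubmodule b lam := by
  classical
  suffices serreSubmodule b lam ≤ (serreSubmodule b lam).comap (wordE b lam i) from this hm
  refine Submodule.span_le.mpr ?_
  rintro - ⟨w, x, hx, rfl⟩
  rw [SetLike.mem_coe, Submodule.mem_comap]
  induction w with
  | nil =>
    rw [List.map_nil, List.prod_nil, Module.End.one_apply, ← coverAct_coverE]
    have hbr : coverProj b lam ⁅coverE b lam i, x⁆ = 0 := by rw [LieHom.map_lie, hx, lie_zero]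
    have h1 := coverAct_single_nil_mem_serreSubmodule b lam hbr
    rwa [LieHom.map_lie, lie_end_word_apply, coverAct_coverE, wordE_single_nil, map_zero,
      sub_zero] at h1
  | cons j w ih =>
    rw [List.map_cons, List.prod_cons, Module.End.mul_apply]
    set z := (w.map wordF).prod (coverAct b lam x (Finsupp.single [] 1)) with hz
    have hzm : z ∈ serreSubmodule b lam := Submodule.subset_span ⟨w, x, hx, hz⟩
    have h1 := congrArg (fun T : Module.End ℂ (List ι →₀ ℂ) => T z) (lie_wordE_wordF b lam i j)
    simp only [lie_end_word_apply] at h1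
    rw [sub_eq_iff_eq_add.mp h1]
    refine add_mem ?_ (wordF_mem_serreSubmodule j ih)
    split_ifs
    · exact wordH_mem_serreSubmodule i hzm
    · exact zero_mem _

theorem coverAct_mem_serreSubmodule (x : wordCover b lam) {m : List ι →₀ ℂ}
    (hm : m ∈ serreSubmodule b lam) : coverAct b lam x m ∈ serreSubmodule b lam := by
  have hx : x ∈ LieSubalgebra.lieSpan ℂ (wordCover b lam)
      (Set.range (coverE b lam) ∪ Set.range (coverF b lam)) := by
    rw [lieSpan_coverE_coverF]; trivial
  induction hx using LieSubalgebra.lieSpan_induction generalizing m with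
  | mem y hy =>
    rcases hy with ⟨i, rfl⟩ | ⟨i, rfl⟩
    · exact wordE_mem_serreSubmodule i hm
    · exact wordF_mem_serreSubmodule i hm
  | zero => simp
  | add y z _ _ hy hz => rw [map_add, LinearMap.add_apply]; exact add_mem (hy hm) (hz hm)
  | smul t y _ hy => rw [map_smul, LinearMap.smul_apply]; exact Submodule.smul_mem _ t (hy hm)
  | lie y z _ _ hy hz =>
    rw [LieHom.map_lie, lie_end_word_apply]
    exact sub_mem (hy (hz hm)) (hz (hy hm))

/-- The kernel of the projection to `𝔤` maps all words into the submodule, being an ideal. -/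
theorem coverAct_mem_serreSubmodule_of_coverProj_eq_zero {x : wordCover b lam}
    (hx : coverProj b lam x = 0) (m : List ι →₀ ℂ) :
    coverAct b lam x m ∈ serreSubmodule b lam := by
  induction m using Finsupp.induction_linear with
  | zero => simp
  | add m n hm hn => rw [map_add]; exact add_mem hm hn
  | single w c =>
    rw [← mul_one c, ← smul_eq_mul, ← Finsupp.smul_single, map_smul]
    refine Submodule.smul_mem _ c ?_
    induction w generalizing x with
    | nil => exact coverAct_single_nil_mem_serreSubmodule b lam hx
    | cons i w ih =>
      have hbr : coverProj b lam ⁅x, coverF b lam i⁆ = 0 := by rw [LieHom.map_lie, hx, zero_lie]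
      have h1 := ih hbr
      rw [LieHom.map_lie, lie_end_word_apply, coverAct_coverF, wordF_single] at h1
      exact (Submodule.sub_mem_iff_left _ (wordF_mem_serreSubmodule i (ih hx))).mp h1

variable (b lam)

/-- The operator of an element of `𝔤` on the quotient of the space of words: that of any of its
lifts to the cover. -/
def serreAct (x : 𝔤) : Module.End ℂ ((List ι →₀ ℂ) ⧸ serreSubmodule b lam) :=
  Submodule.mapQ _ _ (coverAct b lam (Function.surjInv (coverProj_surjective b lam) x))
    fun _ hm => coverAct_mem_serreSubmodule _ hm

theorem serreAct_coverProj_mkQ (x : wordCover b lam) (m : List ι →₀ ℂ) :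
    serreAct b lam (coverProj b lam x) ((serreSubmodule b lam).mkQ m) =
      (serreSubmodule b lam).mkQ (coverAct b lam x m) := by
  rw [serreAct, Submodule.mkQ_apply, Submodule.mapQ_apply, Submodule.mkQ_apply,
    Submodule.Quotient.eq]
  have h := coverAct_mem_serreSubmodule_of_coverProj_eq_zero
    (x := Function.surjInv (coverProj_surjective b lam) (coverProj b lam x) - x)
    (by rw [map_sub, Function.surjInv_eq (coverProj_surjective b lam), sub_self]) m
  rwa [map_sub, LinearMap.sub_apply] at h

/-- The representation of `𝔤` on the quotient of the space of words. -/
def serreHom : 𝔤 →ₗ⁅ℂ⁆ Module.End ℂ ((List ι →₀ ℂ) ⧸ serreSubmodule b lam) where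
  toFun := serreAct b lam
  map_add' x y := by
    obtain ⟨x, rfl⟩ := coverProj_surjective b lam x
    obtain ⟨y, rfl⟩ := coverProj_surjective b lam y
    refine Submodule.linearMap_qext _ (LinearMap.ext fun m => ?_)
    simp only [LinearMap.comp_apply, LinearMap.add_apply, ← map_add, serreAct_coverProj_mkQ]
    rw [map_add, LinearMap.add_apply]
  map_smul' c x := by
    obtain ⟨x, rfl⟩ := coverProj_surjective b lam x
    refine Submodule.linearMap_qext _ (LinearMap.ext fun m => ?_)
    simp only [LinearMap.comp_apply, LinearMap.smul_apply, RingHom.id_apply]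
    rw [← map_smul, serreAct_coverProj_mkQ, serreAct_coverProj_mkQ, ← map_smul, map_smul,
      LinearMap.smul_apply]
  map_lie' {x y} := by
    obtain ⟨x, rfl⟩ := coverProj_surjective b lam x
    obtain ⟨y, rfl⟩ := coverProj_surjective b lam y
    refine Submodule.linearMap_qext _ (LinearMap.ext fun m => ?_)
    rw [← LieHom.map_lie]
    change serreAct b lam _ ((serreSubmodule b lam).mkQ m) =
      serreAct b lam _ (serreAct b lam _ ((serreSubmodule b lam).mkQ m)) -
        serreAct b lam _ (serreAct b lam _ ((serreSubmodule b lam).mkQ m))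
    simp only [serreAct_coverProj_mkQ, ← map_sub]
    rw [LieHom.map_lie, lie_end_word_apply]

theorem exists_sum_h' (h : 𝔥) : ∃ c : ι → ℂ, h = ∑ i, c i • b.h' i := by
  have hh : (h : 𝔤) ∈ Submodule.span ℂ (Set.range b.h) := by
    rw [← b.coe_cartan_eq_span]; exact h.2
  obtain ⟨c, hc⟩ := (Submodule.mem_span_range_iff_exists_fun ℂ).mp hh
  refine ⟨c, Subtype.ext ?_⟩
  rw [← hc]
  have : ∀ s : Finset ι, ((∑ i ∈ s, c i • b.h' i : 𝔥) : 𝔤) = ∑ i ∈ s, c i • b.h i := by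
    classical
    intro s
    induction s using Finset.induction_on with
    | empty => simp
    | insert i s hi ih =>
      rw [Finset.sum_insert hi, Finset.sum_insert hi, ← ih]
      rfl
  exact (this Finset.univ).symm

/-- The Verma module does not vanish: it maps to the quotient of the space of words, sending its
generator to the class of the empty word. -/
theorem vermaIdeal_ne_top : vermaIdeal b lam ≠ ⊤ := by
  set v0 := (serreSubmodule b lam).mkQ (Finsupp.single [] 1) with hv0
  set Φ := UniversalEnvelopingAlgebra.lift ℂ (serreHom b lam)
  have hΦ : ∀ x : wordCover b lam, Φ (toU (coverProj b lam x)) v0 =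
      (serreSubmodule b lam).mkQ (coverAct b lam x (Finsupp.single [] 1)) := fun x => by
    rw [← serreAct_coverProj_mkQ]
    exact congrArg (fun T : Module.End ℂ _ => T v0)
      (UniversalEnvelopingAlgebra.lift_ι_apply ℂ (serreHom b lam) (coverProj b lam x))
  have key : ∀ a ∈ vermaIdeal b lam, Φ a v0 = 0 := by
    intro a ha
    induction ha using Submodule.span_induction with
    | zero => simp
    | add x y _ _ hx hy => rw [map_add, LinearMap.add_apply, hx, hy, add_zero]
    | smul c x _ hx => rw [smul_eq_mul, map_mul, Module.End.mul_apply, hx, map_zero]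
    | mem x hx =>
      rcases hx with ⟨i, rfl⟩ | ⟨h, rfl⟩
      · have := hΦ (coverE b lam i)
        rwa [coverProj_coverE, coverAct_coverE, wordE_single_nil, map_zero] at this
      · rw [map_sub, LinearMap.sub_apply, sub_eq_zero, AlgHom.commutes,
          Module.algebraMap_end_apply]
        obtain ⟨c, rfl⟩ := exists_sum_h' b h
        have hx : coverProj b lam (∑ i, c i • coverH b lam i) =
            ((∑ i, c i • b.h' i : 𝔥) : 𝔤) := by
          rw [map_sum, AddSubmonoidClass.coe_finsetSum]
          exact Finset.sum_congr rfl fun i _ => by rw [map_smul, coverProj_coverH]; rfl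
        rw [← hx, hΦ, map_sum, map_sum, LinearMap.sum_apply, map_sum, Finset.sum_smul]
        refine Finset.sum_congr rfl fun i _ => ?_
        rw [map_smul, LinearMap.smul_apply, coverAct_coverH, wordH_single, map_smul, map_smul,
          map_smul, smul_eq_mul, mul_smul, ← hv0]
        simp [wordWeight]
  intro htop
  have h1 := key 1 (by rw [htop]; trivial)
  rw [map_one, Module.End.one_apply, hv0, Submodule.mkQ_apply, Submodule.Quotient.mk_eq_zero] at h1
  exact single_nil_notMem_serreSubmodule h1

end SerreSubmodule

end NonvanishingOfVerma

/-! ### The vectors defining higher order Verma modules -/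

section Holes

variable {ι : Type v} [Fintype ι] [DecidableEq ι] {b : LieAlgebra.Basis ι 𝔥}
  {lam : Module.Dual ℂ 𝔥}
  {V : Type w} [AddCommGroup V] [Module ℂ V] [Module (Ug 𝔤) V] [IsScalarTower ℂ (Ug 𝔤) V]

omit [DecidableEq ι] in
variable (b) in
/-- A product of powers of lowering operators, not all trivial, is a nonempty word. -/
theorem exists_word_eq_fProd {K : Finset ι} (hK : K.Nonempty) {n : ι → ℕ} (hn : ∀ i, n i ≠ 0) :
    ∃ w : List ι, w ≠ [] ∧ fProd b K n = (w.map fun i => toU (b.f i)).prod := by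
  refine ⟨K.toList.flatMap fun i => List.replicate (n i) i, ?_, ?_⟩
  · obtain ⟨i, hi⟩ := hK
    exact List.ne_nil_of_mem (List.mem_flatMap.mpr
      ⟨i, Finset.mem_toList.mpr hi, List.mem_replicate.mpr ⟨hn i, rfl⟩⟩)
  · unfold fProd
    induction K.toList with
    | nil => simp
    | cons i l ih =>
      rw [List.map_cons, List.prod_cons, List.flatMap_cons, List.map_append, List.prod_append, ih,
        List.map_replicate, List.prod_replicate]

/-- The submodule generated by `∏_{h ∈ K} f_h ^ (⟨λ, α_h^∨⟩ + 1) v` is strictly below the weight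
`λ`, since this vector is singular. -/
theorem smul_fHole_smul_mem_lowerPart [FiniteDimensional ℂ 𝔤] {K : Finset ι} (hK : K ∈ Indep b)
    (hKJ : K ⊆ integrability b lam) (hne : K.Nonempty) {v : V} (hv : IsSingular b lam v)
    (a : Ug 𝔤) : a • fHole b lam K • v ∈ lowerPart b lam V := by
  obtain ⟨w, hw, hwK⟩ := exists_word_eq_fProd b hne (n := fun i => pairingNat b lam i + 1)
    fun _ => Nat.succ_ne_zero _
  have hy : IsSingular b (wordWeight b lam w) (fHole b lam K • v) :=
    { e_smul := e_smul_fHole_smul b hK hKJ hv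
      h_smul := fun h => by rw [fHole, hwK]; exact toU_h_smul_word_smul hv h w }
  refine smul_mem_of_word_smul_mem hy _ (fun w' => word_smul_mem_lowerPart hy w' ?_) a
  rw [wordWeight_rhoCheck, sub_sub, Ne, sub_eq_self, ← Nat.cast_add, Nat.cast_eq_zero]
  have := List.length_pos_of_ne_nil hw
  omega

theorem inter_mem_Indep {H : Finset ι} (hH : H ∈ Indep b) (J : Finset ι) : J ∩ H ∈ Indep b :=
  indep_mono b hH Finset.inter_subset_right

omit [Module ℂ V] [IsScalarTower ℂ (Ug 𝔤) V] in
theorem fHole_smul_eq_zero_of_subset [FiniteDimensional ℂ 𝔤] {H K : Finset ι} (hH : H ∈ Indep b)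
    (hK : K ⊆ H) {v : V} (hv : fHole b lam K • v = 0) : fHole b lam H • v = 0 := by
  obtain ⟨a, ha⟩ := exists_fProd_eq_mul b hH hK (m := fun h => pairingNat b lam h + 1)
    (n := fun h => pairingNat b lam h + 1) fun _ _ => le_rfl
  rw [fHole, ha, mul_smul]
  exact (congrArg _ hv).trans (smul_zero a)

omit [Fintype ι] [DecidableEq ι] in
theorem exists_minimalHoles_subset {ℋ : Set (Finset ι)} {H : Finset ι} (hH : H ∈ ℋ) :
    ∃ K ∈ minimalHoles ℋ, K ⊆ H := by
  obtain ⟨K, hKH, hK⟩ := exists_minimal_le_of_wellFoundedLT (· ∈ ℋ) H hH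
  exact ⟨K, hK, hKH⟩

/-- A highest weight module lies in `𝒪^ℋ` if and only if the vectors defining `𝕄(λ, ℋ)` vanish
in it. -/
theorem IsHighestWeightVector.memOH_iff [FiniteDimensional ℂ 𝔤] {v : V}
    (hv : IsHighestWeightVector b lam v) {ℋ : Set (Finset ι)} (hℋ : ℋ ⊆ Indep b) :
    MemOH b ℋ V ↔ ∀ H ∈ minimalHoles ℋ, fHole b lam (integrability b lam ∩ H) • v = 0 := by
  constructor
  · intro h H hH
    obtain ⟨N, hN⟩ := h.locallyNilpotent H hH.1 v
    rw [fProd_one_pow b (hℋ hH.1)] at hN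
    exact fHole_smul_eq_zero_of_fProd_smul_eq_zero b (hℋ hH.1) _ (fun i _ => hv.e_smul i)
      (fun i _ => hv.h_i_smul i) hN
  · intro h
    refine ⟨hv.memO, fun H hH x => ?_⟩
    obtain ⟨H₀, hH₀, hsub⟩ := exists_minimalHoles_subset hH
    obtain ⟨a, rfl⟩ := hv.generates x
    refine exists_fProd_one_pow_smul_smul_eq_zero b (hℋ hH) ?_ a
    -- A common bound for the exponents `⟨λ, α_h^∨⟩ + 1`.
    refine ⟨Finset.univ.sup fun i => pairingNat b lam i + 1, ?_⟩
    obtain ⟨c, hc⟩ := exists_fProd_eq_mul b (hℋ hH)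
      (K := integrability b lam ∩ H₀) (Finset.inter_subset_right.trans hsub)
      (m := fun _ => Finset.univ.sup fun i => pairingNat b lam i + 1)
      (n := fun h => pairingNat b lam h + 1)
      (fun i _ => Finset.le_sup (f := fun i => pairingNat b lam i + 1) (Finset.mem_univ i))
    rw [fProd_one_pow b (hℋ hH), hc, mul_smul]
    exact (congrArg _ (h H₀ hH₀)).trans (smul_zero c)

omit [DecidableEq ι] in
theorem IsHighestWeightVector.mem_holes_iff {v : V} (hv : IsHighestWeightVector b lam v)
    {H : Finset ι} : H ∈ holes b lam V ↔
      H ∈ Indep b ∧ H ⊆ integrability b lam ∧ fHole b lam H • v = 0 := by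
  refine and_congr_right fun _ => and_congr_right fun _ => ⟨fun h => h v hv.mem_weightSpace, ?_⟩
  intro h x hx
  obtain ⟨c, rfl⟩ := hv.exists_eq_smul hx
  rw [smul_smul_comm, h, smul_zero]

theorem IsHighestWeightVector.memOH_iff_restrictedHoles_subset [FiniteDimensional ℂ 𝔤] {v : V}
    (hv : IsHighestWeightVector b lam v) {ℋ : Set (Finset ι)} (hℋ : ℋ ⊆ Indep b) :
    MemOH b ℋ V ↔ restrictedHoles b lam ℋ ⊆ holes b lam V := by
  rw [hv.memOH_iff hℋ, restrictedHoles, Set.image_subset_iff]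
  refine forall₂_congr fun H hH => ?_
  rw [Set.mem_preimage, hv.mem_holes_iff]
  exact ⟨fun h => ⟨inter_mem_Indep (hℋ hH.1) _, Finset.inter_subset_left, h⟩, fun h => h.2.2⟩

end Holes

/-! ### The modules `M(λ)`, `L(λ)` and `𝕄(λ, ℋ)` -/

section Verma

variable {ι : Type v} [Fintype ι] (b : LieAlgebra.Basis ι 𝔥) (lam : Module.Dual ℂ 𝔥)

/-- The canonical generator of the Verma module. -/
def vermaVec : Verma b lam := (vermaIdeal b lam).mkQ 1

theorem isHighestWeightVector_vermaVec : IsHighestWeightVector b lam (vermaVec b lam) where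
  e_smul i := by
    rw [vermaVec, ← map_smul, smul_eq_mul, mul_one]
    exact (Submodule.Quotient.mk_eq_zero _).mpr (Submodule.subset_span (Or.inl ⟨i, rfl⟩))
  h_smul h := by
    rw [← algebraMap_smul (Ug 𝔤), vermaVec, ← map_smul, ← map_smul, smul_eq_mul, smul_eq_mul,
      mul_one, mul_one]
    exact (Submodule.Quotient.eq _).mpr (Submodule.subset_span (Or.inr ⟨h, rfl⟩))
  generates x := by
    obtain ⟨a, rfl⟩ := Submodule.mkQ_surjective _ x
    exact ⟨a, by rw [vermaVec, ← map_smul, smul_eq_mul, mul_one]⟩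

theorem vermaVec_ne_zero : vermaVec b lam ≠ 0 := by
  intro h
  apply vermaIdeal_ne_top b lam
  rw [eq_top_iff]
  intro a _
  have := (vermaIdeal b lam).smul_mem a ((Submodule.Quotient.mk_eq_zero _).mp h)
  rwa [smul_eq_mul, mul_one] at this

/-- The sum of the proper submodules of the Verma module. -/
abbrev vermaRadical : Submodule (Ug 𝔤) (Verma b lam) :=
  sSup {N : Submodule (Ug 𝔤) (Verma b lam) | N ≠ ⊤}

theorem vermaVec_notMem_vermaRadical : vermaVec b lam ∉ vermaRadical b lam := by
  intro h
  refine vermaVec_ne_zero b lam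
    ((isHighestWeightVector_vermaVec b lam).eq_zero_of_mem_lowerPart ?_)
  rw [vermaRadical, sSup_eq_iSup'] at h
  generalize vermaVec b lam = y at h ⊢
  induction h using Submodule.iSup_induction' with
  | mem N x hx => exact (isHighestWeightVector_vermaVec b lam).mem_lowerPart_of_mem N.2 hx
  | zero => exact zero_mem _
  | add x y _ _ hx hy => exact add_mem hx hy

/-- The generator of `L(λ)`. -/
def simpleVec : Simple b lam := (vermaRadical b lam).mkQ (vermaVec b lam)

theorem isHighestWeightVector_simpleVec : IsHighestWeightVector b lam (simpleVec b lam) :=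
  (isHighestWeightVector_vermaVec b lam).map _ (Submodule.mkQ_surjective _)

theorem simpleVec_ne_zero : simpleVec b lam ≠ 0 := fun h =>
  vermaVec_notMem_vermaRadical b lam ((Submodule.Quotient.mk_eq_zero _).mp h)

variable [DecidableEq ι]

theorem holesSubmodule_le_iff {ℋ : Set (Finset ι)} {N : Submodule (Ug 𝔤) (Verma b lam)} :
    holesSubmodule b lam ℋ ≤ N ↔
      ∀ H ∈ minimalHoles ℋ, fHole b lam (integrability b lam ∩ H) • vermaVec b lam ∈ N := by
  rw [holesSubmodule, iSup₂_le_iff]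
  refine forall₂_congr fun H _ => ?_
  rw [Submodule.span_le, Set.image_subset_iff]
  constructor
  · intro h
    exact h (isHighestWeightVector_vermaVec b lam).mem_weightSpace
  · intro h x hx
    obtain ⟨c, rfl⟩ := (isHighestWeightVector_vermaVec b lam).exists_eq_smul hx
    rw [Set.mem_preimage, smul_smul_comm, ← algebraMap_smul (Ug 𝔤)]
    exact N.smul_mem _ h

theorem fHole_smul_vermaVec_mem {ℋ : Set (Finset ι)} {H : Finset ι} (hH : H ∈ minimalHoles ℋ) :
    fHole b lam (integrability b lam ∩ H) • vermaVec b lam ∈ holesSubmodule b lam ℋ :=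
  (holesSubmodule_le_iff b lam).mp le_rfl H hH

theorem fHole_smul_vermaVec_mem_vermaRadical [FiniteDimensional ℂ 𝔤] {K : Finset ι}
    (hK : K ∈ Indep b) (hKJ : K ⊆ integrability b lam) (hne : K.Nonempty) :
    fHole b lam K • vermaVec b lam ∈ vermaRadical b lam := by
  have hprop : Submodule.span (Ug 𝔤) {fHole b lam K • vermaVec b lam} ≠ ⊤ := by
    intro htop
    have h1 : vermaVec b lam ∈ Submodule.span (Ug 𝔤) {fHole b lam K • vermaVec b lam} := by
      rw [htop]; trivial
    obtain ⟨a, ha⟩ := Submodule.mem_span_singleton.mp h1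
    have hv := (isHighestWeightVector_vermaVec b lam).toIsSingular
    have h2 := smul_fHole_smul_mem_lowerPart hK hKJ hne hv a
    rw [ha] at h2
    exact vermaVec_ne_zero b lam (hv.eq_zero_of_mem_lowerPart h2)
  exact le_sSup (a := Submodule.span (Ug 𝔤) {fHole b lam K • vermaVec b lam}) hprop
    (Submodule.mem_span_singleton_self _)

theorem fHole_smul_simpleVec_eq_zero_iff [FiniteDimensional ℂ 𝔤] {K : Finset ι}
    (hK : K ∈ Indep b) (hKJ : K ⊆ integrability b lam) :
    fHole b lam K • simpleVec b lam = 0 ↔ K.Nonempty := by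
  constructor
  · intro h
    by_contra hne
    rw [Finset.not_nonempty_iff_eq_empty.mp hne, fHole, fProd_empty, one_smul] at h
    exact simpleVec_ne_zero b lam h
  · intro hne
    rw [simpleVec, ← map_smul]
    exact (Submodule.Quotient.mk_eq_zero _).mpr
      (fHole_smul_vermaVec_mem_vermaRadical b lam hK hKJ hne)

theorem memOH_simple_iff [FiniteDimensional ℂ 𝔤] {ℋ : Set (Finset ι)} (hℋ : ℋ ⊆ Indep b) :
    MemOH b ℋ (Simple b lam) ↔
      ∀ H ∈ minimalHoles ℋ, (integrability b lam ∩ H).Nonempty := by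
  rw [(isHighestWeightVector_simpleVec b lam).memOH_iff hℋ]
  exact forall₂_congr fun H hH => fHole_smul_simpleVec_eq_zero_iff b lam
    (inter_mem_Indep (hℋ hH.1) _) Finset.inter_subset_left

theorem holesSubmodule_le_vermaRadical [FiniteDimensional ℂ 𝔤] {ℋ : Set (Finset ι)}
    (hℋ : ℋ ⊆ Indep b) (h : ∀ H ∈ minimalHoles ℋ, (integrability b lam ∩ H).Nonempty) :
    holesSubmodule b lam ℋ ≤ vermaRadical b lam :=
  (holesSubmodule_le_iff b lam).mpr fun H hH => fHole_smul_vermaVec_mem_vermaRadical b lam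
    (inter_mem_Indep (hℋ hH.1) _) Finset.inter_subset_left (h H hH)

theorem nontrivial_higherVerma_iff [FiniteDimensional ℂ 𝔤] {ℋ : Set (Finset ι)}
    (hℋ : ℋ ⊆ Indep b) :
    Nontrivial (HigherVerma b lam ℋ) ↔
      ∀ H ∈ minimalHoles ℋ, (integrability b lam ∩ H).Nonempty := by
  rw [Submodule.Quotient.nontrivial_iff]
  constructor
  · intro hne H hH
    by_contra hemp
    have h1 := fHole_smul_vermaVec_mem b lam hH
    rw [Finset.not_nonempty_iff_eq_empty.mp hemp, fHole, fProd_empty, one_smul] at h1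
    apply hne
    rw [eq_top_iff]
    intro x _
    obtain ⟨a, rfl⟩ := (isHighestWeightVector_vermaVec b lam).generates x
    exact Submodule.smul_mem _ a h1
  · intro h htop
    exact vermaVec_notMem_vermaRadical b lam
      (holesSubmodule_le_vermaRadical b lam hℋ h (by rw [htop]; trivial))

theorem holesSubmodule_restrictedHoles [FiniteDimensional ℂ 𝔤] {ℋ : Set (Finset ι)}
    (hℋ : ℋ ⊆ Indep b) :
    holesSubmodule b lam (restrictedHoles b lam ℋ) = holesSubmodule b lam ℋ := by
  refine le_antisymm ((holesSubmodule_le_iff b lam).mpr ?_)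
    ((holesSubmodule_le_iff b lam).mpr ?_)
  · rintro K hK
    obtain ⟨H, hH, rfl⟩ := hK.1
    dsimp only
    rw [← Finset.inter_assoc, Finset.inter_self]
    exact fHole_smul_vermaVec_mem b lam hH
  · intro H hH
    obtain ⟨K, hK, hKH⟩ := exists_minimalHoles_subset
      (ℋ := restrictedHoles b lam ℋ) (H := integrability b lam ∩ H) ⟨H, hH, rfl⟩
    have h1 := fHole_smul_vermaVec_mem b lam hK
    rw [Finset.inter_eq_right.mpr (hKH.trans Finset.inter_subset_left)] at h1
    have h2 := fHole_smul_eq_zero_of_subset (lam := lam) (inter_mem_Indep (hℋ hH.1) _) hKH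
      (v := (holesSubmodule b lam (restrictedHoles b lam ℋ)).mkQ (vermaVec b lam))
      (by rw [← map_smul]; exact (Submodule.Quotient.mk_eq_zero _).mpr h1)
    rw [← map_smul] at h2
    exact (Submodule.Quotient.mk_eq_zero _).mp h2

/-- The generator of `𝕄(λ, ℋ)`. -/
def higherVermaVec (ℋ : Set (Finset ι)) : HigherVerma b lam ℋ :=
  (holesSubmodule b lam ℋ).mkQ (vermaVec b lam)

theorem isHighestWeightVector_higherVermaVec (ℋ : Set (Finset ι)) :
    IsHighestWeightVector b lam (higherVermaVec b lam ℋ) :=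
  (isHighestWeightVector_vermaVec b lam).map _ (Submodule.mkQ_surjective _)

theorem fHole_smul_higherVermaVec {ℋ : Set (Finset ι)} {H : Finset ι}
    (hH : H ∈ minimalHoles ℋ) :
    fHole b lam (integrability b lam ∩ H) • higherVermaVec b lam ℋ = 0 := by
  rw [higherVermaVec, ← map_smul]
  exact (Submodule.Quotient.mk_eq_zero _).mpr (fHole_smul_vermaVec_mem b lam hH)

theorem memOH_higherVerma [FiniteDimensional ℂ 𝔤] {ℋ : Set (Finset ι)} (hℋ : ℋ ⊆ Indep b) :
    MemOH b ℋ (HigherVerma b lam ℋ) :=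
  ((isHighestWeightVector_higherVermaVec b lam ℋ).memOH_iff hℋ).mpr fun _ hH =>
    fHole_smul_higherVermaVec b lam hH

variable {b lam} in
/-- `𝕄(λ, ℋ)` maps to every highest weight module in which the vectors defining it vanish, with
prescribed image of the generator. -/
theorem exists_higherVerma_hom {V : Type w} [AddCommGroup V] [Module ℂ V] [Module (Ug 𝔤) V]
    [IsScalarTower ℂ (Ug 𝔤) V] (π : Verma b lam →ₗ[Ug 𝔤] V) {ℋ : Set (Finset ι)}
    (h : ∀ H ∈ minimalHoles ℋ,
      fHole b lam (integrability b lam ∩ H) • π (vermaVec b lam) = 0) (c : ℂ) :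
    ∃ g : HigherVerma b lam ℋ →ₗ[Ug 𝔤] V,
      g (higherVermaVec b lam ℋ) = c • π (vermaVec b lam) := by
  have hle : holesSubmodule b lam ℋ ≤ LinearMap.ker π :=
    (holesSubmodule_le_iff b lam).mpr fun H hH => by
      rw [LinearMap.mem_ker, map_smul]; exact h H hH
  have : SMulCommClass (Ug 𝔤) ℂ V := smulCommClass_Ug.symm
  refine ⟨c • (holesSubmodule b lam ℋ).liftQ π hle, ?_⟩
  rw [LinearMap.smul_apply, higherVermaVec, Submodule.mkQ_apply, Submodule.liftQ_apply]

/-- The invariant `ℋ_V` is recovered from `𝕄(λ, ℋ_V)`. -/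
theorem holes_higherVerma_holes [FiniteDimensional ℂ 𝔤] {V : Type w} [AddCommGroup V] [Module ℂ V]
    [Module (Ug 𝔤) V] [IsScalarTower ℂ (Ug 𝔤) V] (π : Verma b lam →ₗ[Ug 𝔤] V)
    (hπ : Function.Surjective π) :
    holes b lam (HigherVerma b lam (holes b lam V)) = holes b lam V := by
  have hv := (isHighestWeightVector_vermaVec b lam).map π hπ
  have hmin : ∀ K ∈ minimalHoles (holes b lam V), integrability b lam ∩ K = K :=
    fun K hK => Finset.inter_eq_right.mpr hK.1.2.1
  ext H
  rw [(isHighestWeightVector_higherVermaVec b lam _).mem_holes_iff, hv.mem_holes_iff]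
  refine and_congr_right fun hH => and_congr_right fun hHJ => ⟨fun h => ?_, fun h => ?_⟩
  · obtain ⟨g, hg⟩ := exists_higherVerma_hom π (ℋ := holes b lam V) (fun K hK => by
      rw [hmin K hK]; exact (hv.mem_holes_iff.mp hK.1).2.2) 1
    rw [one_smul] at hg
    rw [← hg, ← map_smul, h, map_zero]
  · obtain ⟨K, hK, hKH⟩ := exists_minimalHoles_subset (hv.mem_holes_iff.mpr ⟨hH, hHJ, h⟩)
    refine fHole_smul_eq_zero_of_subset hH hKH ?_
    have := fHole_smul_higherVermaVec b lam hK
    rwa [hmin K hK] at this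

theorem isUniversalCover_higherVerma [FiniteDimensional ℂ 𝔤] {ℋ : Set (Finset ι)}
    (hℋ : ℋ ⊆ Indep b) (h : ∀ H ∈ minimalHoles ℋ, (integrability b lam ∩ H).Nonempty) :
    ∃ p : HigherVerma b lam ℋ →ₗ[Ug 𝔤] Simple b lam,
      IsUniversalCover.{u, v, w} b ℋ lam (HigherVerma b lam ℋ) p := by
  have hle := holesSubmodule_le_vermaRadical b lam hℋ h
  refine ⟨Submodule.factor hle, ⟨_, Submodule.mkQ_surjective _⟩, memOH_higherVerma b lam hℋ,
    Submodule.factor_surjective hle, ?_⟩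
  have hp : Submodule.factor hle (higherVermaVec b lam ℋ) = simpleVec b lam := rfl
  have hgen := isHighestWeightVector_higherVermaVec b lam ℋ
  intro V _ _ _ _ ⟨π, hπ⟩ hV q hq
  have hv := (isHighestWeightVector_vermaVec b lam).map π hπ
  set v := π (vermaVec b lam)
  have hqv := hv.map q hq
  obtain ⟨c, hc⟩ := (isHighestWeightVector_simpleVec b lam).exists_eq_smul hqv.mem_weightSpace
  have hqv0 : q v ≠ 0 := by
    intro h0
    obtain ⟨a, ha⟩ := hqv.generates (simpleVec b lam)
    rw [h0, smul_zero] at ha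
    exact simpleVec_ne_zero b lam ha.symm
  have hc0 : c ≠ 0 := by rintro rfl; exact hqv0 (by rw [hc, zero_smul])
  -- The surjection `q` maps the generator `v` to `c` times that of `L(λ)`.
  obtain ⟨g, hg⟩ := exists_higherVerma_hom π ((hv.memOH_iff hℋ).mp hV) c⁻¹
  have hsmul : ∀ (d : ℂ), q (d • v) = d • q v := fun d => by
    rw [← algebraMap_smul (Ug 𝔤), map_smul, algebraMap_smul]
  refine ⟨g, ?_, ?_, ?_⟩
  · intro x
    obtain ⟨a, rfl⟩ := hv.generates x
    refine ⟨a • algebraMap ℂ (Ug 𝔤) c • higherVermaVec b lam ℋ, ?_⟩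
    rw [map_smul, map_smul, hg, algebraMap_smul, smul_smul, mul_inv_cancel₀ hc0, one_smul]
  · refine hgen.hom_ext ?_
    rw [LinearMap.comp_apply, hg, hsmul, hc, smul_smul, inv_mul_cancel₀ hc0, one_smul, hp]
  · intro g' hg'
    refine hgen.hom_ext ?_
    obtain ⟨d, hd⟩ := hv.exists_eq_smul (hgen.toIsSingular.map g').mem_weightSpace
    have h1 : (d * c) • simpleVec b lam = (1 : ℂ) • simpleVec b lam := by
      rw [mul_smul, ← hc, ← hsmul, ← hd, ← LinearMap.comp_apply, hg', hp, one_smul]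
    have h2 : d * c = 1 := smul_left_injective ℂ (simpleVec_ne_zero b lam) h1
    rw [hg, hd, eq_inv_of_mul_eq_one_left h2]

end Verma

end HigherOrderO

end

theorem mainTheorem10 {𝔤 : Type u} [LieRing 𝔤] [LieAlgebra ℂ 𝔤]
    [FiniteDimensional ℂ 𝔤] [LieAlgebra.IsSemisimple ℂ 𝔤] {𝔥 : LieSubalgebra ℂ 𝔤}
    {ι : Type v} [Fintype ι] [DecidableEq ι] (b : LieAlgebra.Basis ι 𝔥)
    (ℋ : Set (Finset ι)) (hℋ : ℋ ⊆ HigherOrderO.Indep b) (hne : ℋ.Nonempty)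
    (lam : Module.Dual ℂ 𝔥) :
    -- (1)
    ((HigherOrderO.MemOH b ℋ (HigherOrderO.Simple b lam) ↔
        ∀ H ∈ HigherOrderO.minimalHoles ℋ, (HigherOrderO.integrability b lam ∩ H).Nonempty) ∧
      (HigherOrderO.MemOH b ℋ (HigherOrderO.Simple b lam) ↔
        Nontrivial (HigherOrderO.HigherVerma b lam ℋ))) ∧
    -- (2)
    (HigherOrderO.MemOH b ℋ (HigherOrderO.Simple b lam) →
      HigherOrderO.holesSubmodule b lam ℋ =
          HigherOrderO.holesSubmodule b lam (HigherOrderO.restrictedHoles b lam ℋ) ∧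
        ∃ p : HigherOrderO.HigherVerma b lam ℋ →ₗ[HigherOrderO.Ug 𝔤] HigherOrderO.Simple b lam,
          HigherOrderO.IsUniversalCover.{u, v, w} b ℋ lam (HigherOrderO.HigherVerma b lam ℋ) p) ∧
    -- (3)
    (HigherOrderO.MemOH b ℋ (HigherOrderO.Simple b lam) →
      ∀ (V : Type w) [AddCommGroup V] [Module ℂ V] [Module (HigherOrderO.Ug 𝔤) V]
        [IsScalarTower ℂ (HigherOrderO.Ug 𝔤) V]
        (pi : HigherOrderO.Verma b lam →ₗ[HigherOrderO.Ug 𝔤] V), Function.Surjective pi →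
        (HigherOrderO.MemOH b ℋ V ↔
            HigherOrderO.restrictedHoles b lam ℋ ⊆ HigherOrderO.holes b lam V) ∧
          (HigherOrderO.MemOH b ℋ V ↔
            HigherOrderO.MemOH b ℋ
              (HigherOrderO.HigherVerma b lam (HigherOrderO.holes b lam V)))) := by
  have hsimple := HigherOrderO.memOH_simple_iff b lam hℋ
  refine ⟨⟨hsimple, hsimple.trans (HigherOrderO.nontrivial_higherVerma_iff b lam hℋ).symm⟩,
    fun h => ⟨(HigherOrderO.holesSubmodule_restrictedHoles b lam hℋ).symm,
      HigherOrderO.isUniversalCover_higherVerma b lam hℋ (hsimple.mp h)⟩, ?_⟩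
  intro _ V _ _ _ _ π hπ
  have hV := ((HigherOrderO.isHighestWeightVector_vermaVec b lam).map π
    hπ).memOH_iff_restrictedHoles_subset hℋ
  refine ⟨hV, ?_⟩
  rw [hV, (HigherOrderO.isHighestWeightVector_higherVermaVec b lam
    _).memOH_iff_restrictedHoles_subset hℋ, HigherOrderO.holes_higherVerma_holes b lam π hπ]
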